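/- Let $T=(V,L)$ be the binary Cayley tree (the infinite tree in which every vertex has exactly $3$ neighbours), let $\beta>0$, $\tau=2\cosh\beta$ and $Q(m)=e^{-\beta|m|}$ for $m\in\mathbb Z$. Fix a root, orient every edge away from it, and let $\Omega^\nabla=\mathbb Z^{\vec L}$ be the space of gradient configurations with the product $\sigma$-algebra. For a height configuration $\omega\in\mathbb Z^V$ put $(\nabla\omega)_{\langle x,y\rangle}=\omega_y-\omega_x$. For finite $\Lambda\subset V$ let $\gamma_\Lambda(\cdot\mid\omega)$ be the probability measure on $\mathbb Z^V$ carried by the configurations $\sigma$ that agree with $\omega$ off $\Lambda$, with weights proportional to $\prod_{b\cap\Lambda\neq\emptyset}Q((\nabla\sigma)_b)$. For $\zeta\in\Omega^\nabla$ let $\gamma'_\Lambda(\cdot\mid\zeta)$ be the image of $\gamma_\Lambda(\cdot\mid\omega)$ under $\nabla$, where $\nabla\omega=\zeta$. A gradient Gibbs measure (GGM) of the SOS model is a probability measure $\nu$ on $\Omega^\nabla$ with $\int\gamma'_\Lambda(A\mid\zeta)\,\nu(d\zeta)=\nu(A)$ for all finite $\Lambda\subset V$ and all measurable $A$. A (spatially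 homogeneous) boundary law is a function $l:\mathbb Z\to(0,\infty)$ such that, for some $c>0$, $l(i)=c\big(\sum_{j\in\mathbb Z}Q(i-j)\,l(j)\big)^2$ for all $i\in\mathbb Z$, with convergent sums. The measure $\nu$ assigned to a $q$-periodic boundary law $l$ is given by the following marginals: for every finite connected non-empty $\Lambda\subset V$ with outer boundary $\partial\Lambda$, every $w\in\Lambda$ and every $\zeta\in\Omega^\nabla$, $$\nu\big(\eta_b=\zeta_b\text{ for all }b\subset\Lambda\cup\partial\Lambda\big)=Z_\Lambda\Big(\sum_{s=0}^{q-1}\ \prod_{y\in\partial\Lambda}l\Big(s+\sum_{b\in\Gamma(w,y)}\zeta_b\Big)\Big)\prod_{b\cap\Lambda\neq\emptyset}Q(\zeta_b),$$ where $Z_\Lambda>0$ is a normalising constant and $\sum_{b\in\Gamma(w,y)}\zeta_b$ is the sum along the path from $w$ to $y$, with a minus sign for edges that the path traverses against their orientation. Consider the GGMs that are assigned in this way to the boundary laws of the $4$-periodic form $z^{(a^2,b^2)}$ with $a,b>0$, where $z^{(a^2,b^2)}_n=1$ for even $n$, $a^2$ for $n\equiv1$ and $b^2$ for $n\equiv3\pmod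 4$. The number of distinct such GGMs is exactly one if $\tau\le4$, exactly two if $4<\tau\le6$, exactly three if $6<\tau\le2+2\sqrt5$, and exactly four if $\tau>2+2\sqrt5$. -/

import Mathlib

open MeasureTheory
open scoped ENNReal

noncomputable section

namespace SOS

variable {V : Type*}

/-- `(x, y)` is an edge of `G` that points away from the root `ρ`. -/
def Oriented (G : SimpleGraph V) (ρ : V) (p : V × V) : Prop :=
  G.Adj p.1 p.2 ∧ G.dist ρ p.2 = G.dist ρ p.1 + 1

/-- The edges of `G`, oriented away from the root `ρ`. -/
abbrev OEdge (G : SimpleGraph V) (ρ : V) : Type _ := {p : V × V // Oriented G ρ p}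

/-- Gradient configurations, with the product σ-algebra (`ℤ` carries its power set). -/
abbrev GradConf (G : SimpleGraph V) (ρ : V) : Type _ := OEdge G ρ → ℤ

/-- The gradient field of a height configuration. -/
def grad (G : SimpleGraph V) (ρ : V) (ω : V → ℤ) : GradConf G ρ :=
  fun b => ω b.1.2 - ω b.1.1

open Classical in
/-- The height increment `ω y - ω x` along a step from `x` to `y`, as prescribed by `ζ`:
the value of `ζ` if the step follows the orientation, minus that value if it goes against it. -/
def stepGrad {G : SimpleGraph V} {ρ : V} (ζ : GradConf G ρ) (x y : V) : ℤ :=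
  if h : Oriented G ρ (x, y) then ζ ⟨(x, y), h⟩
  else if h : Oriented G ρ (y, x) then -ζ ⟨(y, x), h⟩
  else 0

/-- The sum of `ζ` along the unique path from `x` to `y` in the tree `G`. -/
def pathSum {G : SimpleGraph V} (hG : G.IsTree) {ρ : V} (ζ : GradConf G ρ) (x y : V) : ℤ :=
  (((hG.existsUnique_path x y).choose.darts).map fun d => stepGrad ζ d.fst d.snd).sum

/-- The height configuration with gradient field `ζ` and height `0` at the root. -/
def heights {G : SimpleGraph V} (hG : G.IsTree) {ρ : V} (ζ : GradConf G ρ) : V → ℤ :=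
  fun y => pathSum hG ζ ρ y

open Classical in
/-- The outer boundary `∂Λ`: the vertices outside `Λ` with a neighbour in `Λ`. -/
def outerBoundary (G : SimpleGraph V) [G.LocallyFinite] (Λ : Finset V) : Finset V :=
  (Λ.biUnion fun x => G.neighborFinset x) \ Λ

open Classical in
/-- `Λ ∪ ∂Λ`. -/
def closureOf (G : SimpleGraph V) [G.LocallyFinite] (Λ : Finset V) : Finset V :=
  Λ ∪ outerBoundary G Λ

open Classical in
/-- The edges with at least one endpoint in `Λ` (see `mem_edgesMeeting`). -/
def edgesMeeting (G : SimpleGraph V) [G.LocallyFinite] (ρ : V) (Λ : Finset V) :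
    Finset (OEdge G ρ) :=
  ((closureOf G Λ ×ˢ closureOf G Λ).subtype (Oriented G ρ)).filter
    fun b => b.1.1 ∈ Λ ∨ b.1.2 ∈ Λ

theorem mem_edgesMeeting (G : SimpleGraph V) [G.LocallyFinite] (ρ : V) (Λ : Finset V)
    (b : OEdge G ρ) : b ∈ edgesMeeting G ρ Λ ↔ b.1.1 ∈ Λ ∨ b.1.2 ∈ Λ := by
  classical
  obtain ⟨⟨x, y⟩, h, h'⟩ := b
  have hxy : G.Adj x y := h
  have hyx : G.Adj y x := hxy.symm
  simp only [edgesMeeting, closureOf, outerBoundary, Finset.mem_filter, Finset.mem_subtype,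
    Finset.mem_product, Finset.mem_union, Finset.mem_sdiff, Finset.mem_biUnion,
    SimpleGraph.mem_neighborFinset]
  constructor
  · exact fun H => H.2
  · rintro (H | H)
    · exact ⟨⟨Or.inl H, (em (y ∈ Λ)).imp id fun hy => ⟨⟨x, H, hxy⟩, hy⟩⟩, Or.inl H⟩
    · exact ⟨⟨(em (x ∈ Λ)).imp id fun hx => ⟨⟨y, H, hyx⟩, hx⟩, Or.inl H⟩, Or.inr H⟩

/-- The transfer operator of the SOS model, as a function of the height difference. -/
def Q (β : ℝ) (m : ℤ) : ℝ := Real.exp (-β * |(m : ℝ)|)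

open Classical in
/-- The configuration that is `σ` on `Λ` and `ω` off `Λ`. -/
def glue (Λ : Finset V) (σ : Λ → ℤ) (ω : V → ℤ) : V → ℤ :=
  fun x => if h : x ∈ Λ then σ ⟨x, h⟩ else ω x

/-- The Boltzmann weight `exp (-β ∑ |ω x - ω y|)`, over the edges `⟨x, y⟩` that meet `Λ`. -/
def boltzmann (G : SimpleGraph V) [G.LocallyFinite] (ρ : V) (β : ℝ) (Λ : Finset V)
    (ω : V → ℤ) : ℝ≥0∞ :=
  ENNReal.ofReal (∏ b ∈ edgesMeeting G ρ Λ, Q β (grad G ρ ω b))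

/-- The partition function in `Λ` with boundary condition `ω`. -/
def partitionFn (G : SimpleGraph V) [G.LocallyFinite] (ρ : V) (β : ℝ) (Λ : Finset V)
    (ω : V → ℤ) : ℝ≥0∞ :=
  ∑' σ : Λ → ℤ, boltzmann G ρ β Λ (glue Λ σ ω)

/-- The Gibbs specification `γ_Λ(· | ω)` of the SOS model on height configurations. -/
def gibbsSpec (G : SimpleGraph V) [G.LocallyFinite] (ρ : V) (β : ℝ) (Λ : Finset V)
    (ω : V → ℤ) : Measure (V → ℤ) :=
  (partitionFn G ρ β Λ ω)⁻¹ •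
    Measure.sum fun σ : Λ → ℤ =>
      boltzmann G ρ β Λ (glue Λ σ ω) • Measure.dirac (glue Λ σ ω)

/-- The gradient Gibbs specification `γ'_Λ(· | ζ)`: the image under the gradient map of
`γ_Λ(· | ω)`, where `ω` is a height configuration with gradient field `ζ` (the result does not
depend on the height of `ω` at the root, which is set to `0`). -/
def gradSpec {G : SimpleGraph V} [G.LocallyFinite] (hG : G.IsTree) (ρ : V) (β : ℝ)
    (Λ : Finset V) (ζ : GradConf G ρ) : Measure (GradConf G ρ) :=
  (gibbsSpec G ρ β Λ (heights hG ζ)).map (grad G ρ)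

/-- Gradient Gibbs measures: probability measures on gradient configurations that satisfy
the DLR equation `ν γ'_Λ = ν` for every finite set `Λ` of vertices. -/
def IsGGM {G : SimpleGraph V} [G.LocallyFinite] (hG : G.IsTree) (ρ : V) (β : ℝ)
    (ν : Measure (GradConf G ρ)) : Prop :=
  IsProbabilityMeasure ν ∧
    ∀ Λ : Finset V, ∀ A : Set (GradConf G ρ), MeasurableSet A →
      ∫⁻ ζ, gradSpec hG ρ β Λ ζ A ∂ν = ν A

/-- Spatially homogeneous boundary laws of the SOS model on the Cayley tree of order `k`. -/
def IsBoundaryLaw (β : ℝ) (k : ℕ) (l : ℤ → ℝ) : Prop :=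
  (∀ i, 0 < l i) ∧ (∀ i, Summable fun j : ℤ => Q β (i - j) * l j) ∧
    ∃ c : ℝ, 0 < c ∧ ∀ i, l i = c * (∑' j : ℤ, Q β (i - j) * l j) ^ k

/-- `ν` is the measure assigned to the `q`-periodic homogeneous boundary law `l`: for each
finite connected `Λ` and each `w ∈ Λ`, its marginal on the edges in `Λ ∪ ∂Λ` is
`Z_Λ (∑_{s mod q} ∏_{y ∈ ∂Λ} l (s + ∑_{b ∈ Γ(w,y)} ζ_b)) ∏_{b ∩ Λ ≠ ∅} Q(ζ_b)`. -/
def HasMarginals {G : SimpleGraph V} [G.LocallyFinite] (hG : G.IsTree) (ρ : V) (β : ℝ)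
    (q : ℕ) (l : ℤ → ℝ) (ν : Measure (GradConf G ρ)) : Prop :=
  ∀ Λ : Finset V, (G.induce (Λ : Set V)).Connected →
    ∃ Z : ℝ, 0 < Z ∧ ∀ w ∈ Λ, ∀ ζ : GradConf G ρ,
      ν {η | ∀ b : OEdge G ρ, b.1.1 ∈ closureOf G Λ → b.1.2 ∈ closureOf G Λ → η b = ζ b} =
        ENNReal.ofReal (Z *
          (∑ s ∈ Finset.range q, ∏ y ∈ outerBoundary G Λ, l ((s : ℤ) + pathSum hG ζ w y)) *
          ∏ b ∈ edgesMeeting G ρ Λ, Q β (ζ b))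

/-- The 4-periodic function `z` with `(z 0, z 1, z 2, z 3) = (1, a², 1, b²)`. -/
def fourPeriodic (a b : ℝ) (n : ℤ) : ℝ :=
  if n % 4 = 1 then a ^ 2 else if n % 4 = 3 then b ^ 2 else 1

/-- The gradient Gibbs measures on the tree `G` that are assigned to a boundary law, for the
binary tree, of the form `(1, a², 1, b²)` with `a, b > 0`. -/
def fourPeriodicGGMs {G : SimpleGraph V} [G.LocallyFinite] (hG : G.IsTree) (ρ : V) (β : ℝ) :
    Set (Measure (GradConf G ρ)) :=
  {ν | IsGGM hG ρ β ν ∧ ∃ a b : ℝ, 0 < a ∧ 0 < b ∧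
    IsBoundaryLaw β 2 (fourPeriodic a b) ∧ HasMarginals hG ρ β 4 (fourPeriodic a b) ν}

end SOS

end

/-! The kernel `Q` is, up to the factor 2 sinh β, the Green function of f ↦ τ f(i) - f(i+1) - f(i-1)
on ℤ. For a 4-periodic law the boundary law equation therefore becomes a cyclic linear system of
four equations; solving it and taking positive square roots leaves two polynomial equations in a and
b (`isBoundaryLaw_fourPeriodic_iff`). For a = b they say that a = 1 or 2a² - (τ-2)a + 2 = 0, a
quadratic whose roots are mutually inverse, and real, positive and different from 1 exactly when τ >
6. For a ≠ b they say that s = a + b solves s² - τs + τ = 0 and that ab = 2s/τ; such a and b are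
real and distinct exactly when τs > 8, which holds for the larger root s when τ > 4, for the smaller
one when τ > 2 + 2√5, and never when τ ≤ 4.

Each law carries exactly one gradient Gibbs measure. For existence, run a Markov chain of heights
along the tree, with transition weights Q(j) l(k+j), started at s with probability proportional to
the cube of `conv β l s`, where s runs over a period. The boundary law equation makes the
normalisations telescope, which yields the prescribed marginals (`Conn.marg_boundaryLawMeasure`);
the DLR equation follows from detailed balance of the gradient kernel on cylinders
(`Marg.lintegral_gradSpec_cyl`). Uniqueness holds because the marginals on balls determine the
measure (`Marg.unique`).

It remains to decide when two laws share a measure. Shifting a law, or multiplying it by a constant,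
changes nothing, so (a, b) and (b, a) are equivalent, and so are (a, a) and (1/a, 1/a). Conversely,
the marginal on the star at the root gives the sums of l(s+i) l(s+j) l(s+k) over a period, up to a
common factor, and four of these sums exclude every other coincidence (`star_rigidity`). Hence the
constant law, the inverse pair on the diagonal and each admissible sum s contribute one measure
each. -/

noncomputable section

namespace SOS

/-! ### Finite connected subsets of the 3-regular tree -/

section Tree

variable {V : Type*} {G : SimpleGraph V}

/-- The finite vertex set `Λ` induces a connected subgraph. -/
abbrev Conn (G : SimpleGraph V) (Λ : Finset V) : Prop := (G.induce (Λ : Set V)).Connected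

theorem Conn.exists_path {Λ : Finset V} (h : Conn G Λ) {u v : V} (hu : u ∈ Λ) (hv : v ∈ Λ) :
    ∃ p : G.Walk u v, p.IsPath ∧ ∀ x ∈ p.support, x ∈ Λ := by
  obtain ⟨p, hp⟩ := h.exists_isPath ⟨u, hu⟩ ⟨v, hv⟩
  let f : G.induce (Λ : Set V) →g G := (SimpleGraph.Embedding.induce (Λ : Set V)).toHom
  have hf : Function.Injective f := Subtype.val_injective
  have hs : ∀ x ∈ (p.map f).support, x ∈ Λ := by
    intro x hx
    rw [SimpleGraph.Walk.support_map, List.mem_map] at hx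
    obtain ⟨y, -, rfl⟩ := hx
    exact y.2
  exact ⟨p.map f, hp.map hf, hs⟩

theorem path_eq (hG : G.IsTree) {u v : V} {p q : G.Walk u v} (hp : p.IsPath) (hq : q.IsPath) :
    p = q := (hG.existsUnique_path u v).unique hp hq

theorem length_eq_dist (hG : G.IsTree) {u v : V} {p : G.Walk u v} (hp : p.IsPath) :
    p.length = G.dist u v := by
  obtain ⟨q, hq, hl⟩ := hG.1.exists_path_of_dist u v
  rw [path_eq hG hp hq, hl]

/-- A path inside `Λ` from `u` to `u'`, prolonged to `v`, and the edge from `u` to `v` are two paths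
with the same ends, so they have the same length and the first part is trivial. -/
theorem Conn.eq_of_adj (hG : G.IsTree) {Λ : Finset V} (h : Conn G Λ) {u u' v : V} (hu : u ∈ Λ)
    (hu' : u' ∈ Λ) (hv : v ∉ Λ) (huv : G.Adj u v) (huv' : G.Adj u' v) : u = u' := by
  obtain ⟨p, hp, hs⟩ := h.exists_path hu hu'
  have h1 : (p.concat huv').IsPath := hp.concat (fun H => hv (hs _ H)) huv'
  have h2 : (huv.toWalk).IsPath := by simpa using huv.ne
  have := congrArg SimpleGraph.Walk.length (path_eq hG h1 h2)
  rw [SimpleGraph.Walk.length_concat] at this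
  have h3 : huv.toWalk.length = 1 := by simp
  exact SimpleGraph.Walk.eq_of_length_eq_zero (p := p) (by omega)

theorem conn_singleton (w : V) : Conn G {w} := by
  rw [Conn, Finset.coe_singleton]
  exact SimpleGraph.Connected.mk SimpleGraph.Preconnected.of_subsingleton

theorem conn_of_patches {Λ : Finset V} {w : V} (hw : w ∈ Λ)
    (h : ∀ x ∈ Λ, ∃ Λ' ⊆ Λ, Conn G Λ' ∧ w ∈ Λ' ∧ x ∈ Λ') : Conn G Λ := by
  refine SimpleGraph.induce_connected_of_patches w (by simpa using hw) fun {x} hx => ?_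
  obtain ⟨Λ', h1, h2, h3, h4⟩ := h x (by simpa using hx)
  exact ⟨Λ', by exact_mod_cast h1, h3, h4, h2.preconnected _ _⟩

open Classical in
theorem Conn.insert_adj {Λ : Finset V} (h : Conn G Λ) {u v : V} (hu : u ∈ Λ) (huv : G.Adj u v) :
    Conn G (insert v Λ) := by
  have h1 : Conn G {u, v} := by
    rw [Conn, Finset.coe_insert, Finset.coe_singleton]
    exact SimpleGraph.induce_pair_connected_of_adj huv
  refine conn_of_patches (w := u) (by simp [hu]) fun x hx => ?_
  rcases Finset.mem_insert.1 hx with rfl | hx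
  · exact ⟨{u, x}, by intro y; simp; rintro (rfl | rfl) <;> simp [hu], h1, by simp, by simp⟩
  · exact ⟨Λ, Finset.subset_insert _ _, h, hu, hx⟩

theorem Conn.oriented (hG : G.IsTree) {ρ : V} {Λ : Finset V} (h : Conn G Λ) (hρ : ρ ∈ Λ) {u v : V}
    (hu : u ∈ Λ) (hv : v ∉ Λ) (huv : G.Adj u v) : Oriented G ρ (u, v) := by
  obtain ⟨p, hp, hs⟩ := h.exists_path hρ hu
  have h1 : (p.concat huv).IsPath := hp.concat (fun H => hv (hs _ H)) huv
  refine ⟨huv, ?_⟩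
  rw [← length_eq_dist hG h1, ← length_eq_dist hG hp, SimpleGraph.Walk.length_concat]

theorem oriented_or (hG : G.IsTree) (ρ : V) {x y : V} (h : G.Adj x y) :
    Oriented G ρ (x, y) ∨ Oriented G ρ (y, x) := by
  rcases hG.dist_eq_dist_add_one_of_adj ρ h with H | H
  · exact Or.inr ⟨h.symm, H⟩
  · exact Or.inl ⟨h, H⟩

theorem Oriented.not_symm {ρ x y : V} (h : Oriented G ρ (x, y)) : ¬ Oriented G ρ (y, x) := by
  intro h'
  have h1 : G.dist ρ y = G.dist ρ x + 1 := h.2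
  have h2 : G.dist ρ x = G.dist ρ y + 1 := h'.2
  omega

theorem Oriented.concat_isPath (hG : G.IsTree) {ρ x y : V} (h : Oriented G ρ (x, y))
    {p : G.Walk ρ x} (hp : p.IsPath) : (p.concat h.1).IsPath := by
  classical
  refine hp.concat (fun (H : y ∈ p.support) => ?_) h.1
  have h1 := length_eq_dist hG (hp.takeUntil H)
  have h2 := p.length_takeUntil_le_length H
  have h3 : G.dist ρ y = G.dist ρ x + 1 := h.2
  have h4 := length_eq_dist hG hp
  omega

theorem Oriented.fst_unique (hG : G.IsTree) {ρ x x' y : V} (h : Oriented G ρ (x, y))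
    (h' : Oriented G ρ (x', y)) : x = x' := by
  obtain ⟨p, hp, -⟩ := hG.existsUnique_path ρ x
  obtain ⟨p', hp', -⟩ := hG.existsUnique_path ρ x'
  have := path_eq hG (h.concat_isPath hG hp) (h'.concat_isPath hG hp')
  have := congrArg SimpleGraph.Walk.penultimate this
  simpa using this

theorem stepGrad_of_oriented {ρ x y : V} (ζ : GradConf G ρ) (h : Oriented G ρ (x, y)) :
    stepGrad ζ x y = ζ ⟨(x, y), h⟩ := by
  simp [stepGrad, h]

theorem heights_snd (hG : G.IsTree) {ρ : V} (ζ : GradConf G ρ) (b : OEdge G ρ) :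
    heights hG ζ b.1.2 = heights hG ζ b.1.1 + ζ b := by
  obtain ⟨⟨x, y⟩, h⟩ := b
  have hx := (hG.existsUnique_path ρ x).choose_spec.1
  have hy := (hG.existsUnique_path ρ y).choose_spec.1
  have := path_eq hG hy (h.concat_isPath hG hx)
  simp only [heights, pathSum]
  rw [this, SimpleGraph.Walk.darts_concat, List.concat_eq_append, List.map_append, List.sum_append]
  simp [stepGrad_of_oriented ζ h]

theorem grad_heights (hG : G.IsTree) {ρ : V} (ζ : GradConf G ρ) :
    grad G ρ (heights hG ζ) = ζ := by
  funext b
  have := heights_snd hG ζ b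
  simp only [grad]
  omega

theorem stepGrad_grad (hG : G.IsTree) {ρ : V} (ω : V → ℤ) {x y : V} (h : G.Adj x y) :
    stepGrad (grad G ρ ω) x y = ω y - ω x := by
  rcases oriented_or hG ρ h with H | H
  · rw [stepGrad_of_oriented _ H]; rfl
  · have := H.not_symm
    simp only [stepGrad, this, H, dif_pos, dif_neg, not_false_iff, grad]
    ring

theorem walkSum_grad (hG : G.IsTree) {ρ : V} (ω : V → ℤ) {x y : V} (p : G.Walk x y) :
    (p.darts.map fun d => stepGrad (grad G ρ ω) d.fst d.snd).sum = ω y - ω x := by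
  induction p with
  | nil => simp
  | cons h p ih =>
    simp only [SimpleGraph.Walk.darts_cons, List.map_cons, List.sum_cons, ih]
    rw [stepGrad_grad hG ω h]; ring

theorem pathSum_grad (hG : G.IsTree) {ρ : V} (ω : V → ℤ) (x y : V) :
    pathSum hG (grad G ρ ω) x y = ω y - ω x := walkSum_grad hG ω _

/-- The oriented edge that joins two adjacent vertices. -/
theorem exists_oedge (hG : G.IsTree) (ρ : V) {x y : V} (h : G.Adj x y) :
    ∃ e : OEdge G ρ, (e.1 = (x, y) ∨ e.1 = (y, x)) := by
  rcases oriented_or hG ρ h with H | H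
  · exact ⟨⟨_, H⟩, Or.inl rfl⟩
  · exact ⟨⟨_, H⟩, Or.inr rfl⟩

theorem oedge_eq {ρ : V} {x y : V} {e e' : OEdge G ρ}
    (h : e.1 = (x, y) ∨ e.1 = (y, x)) (h' : e'.1 = (x, y) ∨ e'.1 = (y, x)) : e = e' := by
  obtain ⟨e, he⟩ := e
  obtain ⟨e', he'⟩ := e'
  rcases h with rfl | rfl <;> rcases h' with rfl | rfl
  · rfl
  · exact absurd he' he.not_symm
  · exact absurd he' he.not_symm
  · rfl

open Classical in
/-- A connected set grows to a larger connected set by adding one boundary vertex at a time. -/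
theorem Conn.growth {Λ₀ Λ₁ : Finset V} (h₀ : Conn G Λ₀) (h₁ : Conn G Λ₁) (hs : Λ₀ ⊆ Λ₁)
    {P : Finset V → Prop} (base : P Λ₀)
    (step : ∀ Λ u v, Λ₀ ⊆ Λ → Conn G Λ → u ∈ Λ → v ∉ Λ → G.Adj u v → P Λ → P (insert v Λ)) :
    P Λ₁ := by
  suffices H : ∀ n (Λ : Finset V), (Λ₁ \ Λ).card = n → Λ₀ ⊆ Λ → Λ ⊆ Λ₁ → Conn G Λ → P Λ → P Λ₁ from
    H _ Λ₀ rfl subset_rfl hs h₀ base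
  intro n
  induction n with
  | zero =>
    intro Λ hc _ h2 _ hP
    have : Λ = Λ₁ := h2.antisymm (by
      rw [Finset.card_eq_zero] at hc; exact Finset.sdiff_eq_empty_iff_subset.1 hc)
    exact this ▸ hP
  | succ n ih =>
    intro Λ hc hl h2 hconn hP
    obtain ⟨x, hx⟩ : (Λ₁ \ Λ).Nonempty := by
      rw [← Finset.card_pos]; omega
    rw [Finset.mem_sdiff] at hx
    obtain ⟨w, hw⟩ := hconn.nonempty
    obtain ⟨p, -, hp⟩ := h₁.exists_path (h2 hw) hx.1
    -- A path inside `Λ₁` from `Λ` to a missing vertex has to leave `Λ`; the end of the edge by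
    -- which it leaves is the vertex to add.
    obtain ⟨d, hd, hd1, hd2⟩ := p.exists_boundary_dart (Λ : Set V) hw (by simpa using hx.2)
    have hd1' : d.fst ∈ Λ := by simpa using hd1
    have hd2' : d.snd ∉ Λ := by simpa using hd2
    have hd3 : d.snd ∈ Λ₁ := hp _ (p.dart_snd_mem_support_of_mem_darts hd)
    refine ih (insert d.snd Λ) ?_ (hl.trans (Finset.subset_insert _ _))
      (Finset.insert_subset hd3 h2) (hconn.insert_adj hd1' d.adj)
      (step Λ d.fst d.snd hl hconn hd1' hd2' d.adj hP)
    rw [Finset.sdiff_insert, Finset.card_erase_of_mem (by simp [hd3, hd2']), hc]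
    rfl

section Finite

variable [G.LocallyFinite]

theorem mem_outerBoundary {Λ : Finset V} {y : V} :
    y ∈ outerBoundary G Λ ↔ (∃ x ∈ Λ, G.Adj x y) ∧ y ∉ Λ := by
  simp [outerBoundary]

theorem mem_closureOf {Λ : Finset V} {y : V} :
    y ∈ closureOf G Λ ↔ y ∈ Λ ∨ ∃ x ∈ Λ, G.Adj x y := by
  simp only [closureOf, Finset.mem_union, mem_outerBoundary]
  tauto

theorem subset_closureOf (Λ : Finset V) : Λ ⊆ closureOf G Λ :=
  fun _ h => mem_closureOf.2 (Or.inl h)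

theorem Conn.closure {Λ : Finset V} (h : Conn G Λ) : Conn G (closureOf G Λ) := by
  classical
  obtain ⟨w, hw⟩ := h.nonempty
  refine conn_of_patches (w := w) (subset_closureOf _ hw) fun x hx => ?_
  rcases mem_closureOf.1 hx with hx' | ⟨u, hu, hux⟩
  · exact ⟨Λ, subset_closureOf _, h, hw, hx'⟩
  · refine ⟨insert x Λ, ?_, h.insert_adj hu hux, by simp [show w ∈ Λ from hw], by simp⟩
    exact Finset.insert_subset hx (subset_closureOf _)

/-- Two adjacent boundary vertices would close a cycle through `Λ`. This identifies the edges of the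
cylinder events in the marginals with the edges that carry the factors `Q`. -/
theorem Conn.mem_edgesMeeting_iff (hG : G.IsTree) {ρ : V} {Λ : Finset V} (h : Conn G Λ)
    (b : OEdge G ρ) :
    b ∈ edgesMeeting G ρ Λ ↔ b.1.1 ∈ closureOf G Λ ∧ b.1.2 ∈ closureOf G Λ := by
  classical
  rw [mem_edgesMeeting]
  have hb : G.Adj b.1.1 b.1.2 := b.2.1
  constructor
  · rintro (H | H)
    · exact ⟨subset_closureOf _ H, mem_closureOf.2 (Or.inr ⟨_, H, hb⟩)⟩
    · exact ⟨mem_closureOf.2 (Or.inr ⟨_, H, hb.symm⟩), subset_closureOf _ H⟩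
  · rintro ⟨h1, h2⟩
    rw [mem_closureOf] at h1 h2
    by_contra! hc
    obtain ⟨x, hx, hx1⟩ := h1.resolve_left hc.1
    obtain ⟨y, hy, hy2⟩ := h2.resolve_left hc.2
    have hc' := h.insert_adj hx hx1
    have := hc'.eq_of_adj hG (u := y) (u' := b.1.1) (v := b.1.2) (by simp [hy]) (by simp)
      (by simp [hc.2, hb.ne']) hy2 hb
    exact hc.1 (this ▸ hy)

open Classical in
/-- How the boundary and the edges change when a boundary vertex `v` is added to `Λ`: the other
two neighbours `v₁`, `v₂` of `v` replace it in the boundary. -/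
structure Extension (ρ : V) (Λ : Finset V) (v v₁ v₂ : V) (e₁ e₂ : OEdge G ρ) : Prop where
  ne : v₁ ≠ v₂
  adj₁ : G.Adj v v₁
  adj₂ : G.Adj v v₂
  mem : v ∈ outerBoundary G Λ
  notMem₁ : v₁ ∉ closureOf G Λ
  notMem₂ : v₂ ∉ closureOf G Λ
  edge₁ : e₁.1 = (v, v₁) ∨ e₁.1 = (v₁, v)
  edge₂ : e₂.1 = (v, v₂) ∨ e₂.1 = (v₂, v)
  edge_ne : e₁ ≠ e₂
  edge_notMem₁ : e₁ ∉ edgesMeeting G ρ Λ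
  edge_notMem₂ : e₂ ∉ edgesMeeting G ρ Λ
  boundary : outerBoundary G (insert v Λ) = insert v₁ (insert v₂ ((outerBoundary G Λ).erase v))
  closure : closureOf G (insert v Λ) = insert v₁ (insert v₂ (closureOf G Λ))
  edges : edgesMeeting G ρ (insert v Λ) = insert e₁ (insert e₂ (edgesMeeting G ρ Λ))

/-- Of the three neighbours of `v` exactly one lies in `Λ`; the absence of cycles keeps the other
two out of `Λ` and of its boundary. -/
theorem Conn.exists_extension (hG : G.IsTree) (hdeg : G.IsRegularOfDegree 3) (ρ : V)
    {Λ : Finset V} (h : Conn G Λ) {u v : V} (hu : u ∈ Λ) (hv : v ∉ Λ) (huv : G.Adj u v) :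
    ∃ v₁ v₂ e₁ e₂, Extension (G := G) ρ Λ v v₁ v₂ e₁ e₂ := by
  classical
  have hcard : ((G.neighborFinset v).erase u).card = 2 := by
    rw [Finset.card_erase_of_mem (by simpa using huv.symm), SimpleGraph.card_neighborFinset_eq_degree,
      hdeg v]
  obtain ⟨v₁, v₂, hne, hN⟩ := Finset.card_eq_two.1 hcard
  have hadj : ∀ y, G.Adj v y ↔ y = u ∨ y = v₁ ∨ y = v₂ := by
    intro y
    have : y ∈ (G.neighborFinset v).erase u ↔ y = v₁ ∨ y = v₂ := by simp [hN]
    rw [Finset.mem_erase, SimpleGraph.mem_neighborFinset] at this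
    constructor
    · intro hy
      by_cases hyu : y = u
      · exact Or.inl hyu
      · exact Or.inr (this.1 ⟨hyu, hy⟩)
    · rintro (rfl | H)
      · exact huv.symm
      · exact (this.2 H).2
  have hvu : ∀ y, (y = v₁ ∨ y = v₂) → y ≠ u := by
    intro y hy
    have : y ∈ (G.neighborFinset v).erase u := by simp [hN, hy]
    exact (Finset.mem_erase.1 this).1
  have ha₁ : G.Adj v v₁ := (hadj _).2 (by simp)
  have ha₂ : G.Adj v v₂ := (hadj _).2 (by simp)
  have hΛ : ∀ y, G.Adj v y → y ≠ u → y ∉ Λ := fun y hy hyu hyΛ =>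
    hyu (h.eq_of_adj hG hyΛ hu hv hy.symm huv)
  have hins := h.insert_adj hu huv
  have hcl : ∀ y, G.Adj v y → y ≠ u → y ∉ closureOf G Λ := by
    intro y hy hyu hyc
    rcases mem_closureOf.1 hyc with H | ⟨x, hx, hxy⟩
    · exact hΛ y hy hyu H
    · have := hins.eq_of_adj hG (u := x) (u' := v) (v := y) (by simp [hx]) (by simp)
        (by simp [hy.ne', hΛ y hy hyu]) hxy hy
      exact hv (this ▸ hx)
  have h₁ := hcl v₁ ha₁ (hvu _ (by simp))
  have h₂ := hcl v₂ ha₂ (hvu _ (by simp))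
  obtain ⟨e₁, he₁⟩ := exists_oedge hG ρ ha₁
  obtain ⟨e₂, he₂⟩ := exists_oedge hG ρ ha₂
  have hvc : v ∈ closureOf G Λ := mem_closureOf.2 (Or.inr ⟨u, hu, huv⟩)
  have hE : ∀ (e : OEdge G ρ) (y : V), y ∉ closureOf G Λ → (e.1 = (v, y) ∨ e.1 = (y, v)) →
      e ∉ edgesMeeting G ρ Λ := by
    intro e y hy he H
    have := (h.mem_edgesMeeting_iff hG e).1 H
    rcases he with he | he <;> simp [he] at this <;> tauto
  refine ⟨v₁, v₂, e₁, e₂, hne, ha₁, ha₂, mem_outerBoundary.2 ⟨⟨u, hu, huv⟩, hv⟩, h₁, h₂, he₁, he₂,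
    ?_, hE _ _ h₁ he₁, hE _ _ h₂ he₂, ?_, ?_, ?_⟩
  · rintro rfl
    rcases he₁ with he₁ | he₁ <;> rw [he₁] at he₂ <;> simp at he₂ <;> grind
  · ext y
    simp only [mem_outerBoundary, Finset.mem_insert, Finset.mem_erase, exists_eq_or_imp, hadj]
    have hn₁ : v₁ ∉ Λ := fun H => h₁ (subset_closureOf _ H)
    have hn₂ : v₂ ∉ Λ := fun H => h₂ (subset_closureOf _ H)
    have := ha₁.ne
    have := ha₂.ne
    grind
  · ext y
    simp only [mem_closureOf, Finset.mem_insert, exists_eq_or_imp, hadj]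
    grind
  · ext e
    simp only [mem_edgesMeeting, Finset.mem_insert]
    have hea : G.Adj e.1.1 e.1.2 := e.2.1
    constructor
    · rintro ((H | H) | (H | H))
      · rw [H, hadj] at hea
        rcases hea with K | K | K
        · exact Or.inr (Or.inr (Or.inr (K ▸ hu)))
        · exact Or.inl (oedge_eq (x := v) (y := v₁) (Or.inl (by rw [← H, ← K])) he₁)
        · exact Or.inr (Or.inl (oedge_eq (x := v) (y := v₂) (Or.inl (by rw [← H, ← K])) he₂))
      · tauto
      · have hea := hea.symm
        rw [H, hadj] at hea
        rcases hea with K | K | K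
        · exact Or.inr (Or.inr (Or.inl (K ▸ hu)))
        · exact Or.inl (oedge_eq (x := v) (y := v₁) (Or.inr (by rw [← H, ← K])) he₁)
        · exact Or.inr (Or.inl (oedge_eq (x := v) (y := v₂) (Or.inr (by rw [← H, ← K])) he₂))
      · tauto
    · rintro (rfl | rfl | H | H)
      · rcases he₁ with he₁ | he₁ <;> simp [he₁]
      · rcases he₂ with he₂ | he₂ <;> simp [he₂]
      · tauto
      · tauto

theorem Conn.outerBoundary_nonempty (hG : G.IsTree) (hdeg : G.IsRegularOfDegree 3) {Λ : Finset V}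
    (h : Conn G Λ) : (outerBoundary G Λ).Nonempty := by
  classical
  obtain ⟨w, hw⟩ := h.nonempty
  refine Conn.growth (conn_singleton w) h (by simpa using hw)
    (P := fun Λ => (outerBoundary G Λ).Nonempty) ?_ ?_
  · have : 0 < (G.neighborFinset w).card := by
      rw [SimpleGraph.card_neighborFinset_eq_degree, hdeg w]; norm_num
    obtain ⟨y, hy⟩ := Finset.card_pos.1 this
    rw [SimpleGraph.mem_neighborFinset] at hy
    exact ⟨y, mem_outerBoundary.2 ⟨⟨w, by simp, hy⟩, by simpa using hy.ne'⟩⟩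
  · intro Λ u v _ hc hu hv huv _
    obtain ⟨v₁, v₂, e₁, e₂, E⟩ := hc.exists_extension hG hdeg w hu hv huv
    rw [E.boundary]
    exact ⟨v₁, by simp⟩

/-- Height configurations with the same gradients on a connected set differ by a constant. -/
theorem Conn.exists_shift (hG : G.IsTree) {ρ : V} {Λ : Finset V} (h : Conn G Λ) {ω ω' : V → ℤ}
    (he : ∀ b ∈ edgesMeeting G ρ Λ, grad G ρ ω b = grad G ρ ω' b) {w : V}
    (hw : w ∈ closureOf G Λ) {x : V} (hx : x ∈ closureOf G Λ) : ω' x - ω x = ω' w - ω w := by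
  obtain ⟨p, -, hp⟩ := h.closure.exists_path hx hw
  clear hx hw
  induction p with
  | nil => rfl
  | @cons x y w hxy p ih =>
    rw [← ih (fun z hz => hp z (by simp [hz]))]
    have hx := hp x (by simp)
    have hy := hp y (by simp)
    rcases oriented_or hG ρ hxy with H | H
    · have := he ⟨_, H⟩ ((h.mem_edgesMeeting_iff hG _).2 ⟨hx, hy⟩)
      simp only [grad] at this; omega
    · have := he ⟨_, H⟩ ((h.mem_edgesMeeting_iff hG _).2 ⟨hy, hx⟩)
      simp only [grad] at this; omega

/-- The ball of radius `n` around `ρ`. -/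
def ball (G : SimpleGraph V) [G.LocallyFinite] (ρ : V) : ℕ → Finset V
  | 0 => {ρ}
  | n + 1 => closureOf G (ball G ρ n)

theorem conn_ball (ρ : V) (n : ℕ) : Conn G (ball G ρ n) := by
  induction n with
  | zero => exact conn_singleton ρ
  | succ n ih => exact ih.closure

theorem ball_mono (ρ : V) : Monotone (ball G ρ) :=
  monotone_nat_of_le_succ fun _ => subset_closureOf _

theorem root_mem_ball (ρ : V) (n : ℕ) : ρ ∈ ball G ρ n :=
  ball_mono ρ (Nat.zero_le n) (by simp [ball])

theorem exists_mem_ball (hG : G.IsTree) (ρ x : V) : ∃ n, x ∈ ball G ρ n := by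
  obtain ⟨p⟩ := hG.1.preconnected x ρ
  induction p with
  | nil => exact ⟨0, root_mem_ball _ 0⟩
  | cons h p ih =>
    obtain ⟨n, hn⟩ := ih
    exact ⟨n + 1, mem_closureOf.2 (Or.inr ⟨_, hn, h.symm⟩)⟩

theorem exists_subset_ball (hG : G.IsTree) (ρ : V) (Λ : Finset V) : ∃ n, Λ ⊆ ball G ρ n := by
  classical
  induction Λ using Finset.induction_on with
  | empty => exact ⟨0, by simp⟩
  | insert x s _ ih =>
    obtain ⟨n, hn⟩ := ih
    obtain ⟨m, hm⟩ := exists_mem_ball hG ρ x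
    refine ⟨max n m, Finset.insert_subset (ball_mono ρ (le_max_right n m) hm) ?_⟩
    exact hn.trans (ball_mono ρ (le_max_left n m))

end Finite

end Tree

/-! ### Cylinder events and consistency of the marginals -/

section Marginals

variable {V : Type*} {G : SimpleGraph V} [G.LocallyFinite]

/-- The gradient configurations that agree with `ζ` on all edges that meet `Λ`. -/
def cyl {ρ : V} (Λ : Finset V) (ζ : GradConf G ρ) : Set (GradConf G ρ) :=
  {η | ∀ b ∈ edgesMeeting G ρ Λ, η b = ζ b}

/-- The restriction of a gradient configuration to the edges that meet `Λ`. -/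
def restr {ρ : V} (Λ : Finset V) (ζ : GradConf G ρ) : edgesMeeting G ρ Λ → ℤ := fun b => ζ b

theorem measurable_restr {ρ : V} (Λ : Finset V) : Measurable (restr (G := G) (ρ := ρ) Λ) :=
  measurable_pi_lambda _ fun b => measurable_pi_apply b.1

theorem cyl_eq_preimage {ρ : V} (Λ : Finset V) (ζ : GradConf G ρ) :
    cyl Λ ζ = restr Λ ⁻¹' {restr Λ ζ} := by
  ext η
  simp [cyl, restr, funext_iff]

theorem measurableSet_cyl {ρ : V} (Λ : Finset V) (ζ : GradConf G ρ) : MeasurableSet (cyl Λ ζ) := by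
  rw [cyl_eq_preimage]
  exact measurable_restr _ (measurableSet_singleton _)

open Classical in
/-- Extension by `0` of a configuration on the edges that meet `Λ`. -/
def extendZero {ρ : V} (Λ : Finset V) (e : edgesMeeting G ρ Λ → ℤ) : GradConf G ρ :=
  fun b => if h : b ∈ edgesMeeting G ρ Λ then e ⟨b, h⟩ else 0

@[simp] theorem restr_extendZero {ρ : V} (Λ : Finset V) (e : edgesMeeting G ρ Λ → ℤ) :
    restr Λ (extendZero Λ e) = e := by
  funext b
  simp [extendZero, restr]

theorem map_restr_singleton {ρ : V} (Λ : Finset V) (μ : Measure (GradConf G ρ))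
    (e : edgesMeeting G ρ Λ → ℤ) : μ.map (restr Λ) {e} = μ (cyl Λ (extendZero Λ e)) := by
  rw [Measure.map_apply (measurable_restr _) (measurableSet_singleton _), cyl_eq_preimage,
    restr_extendZero]

/-- A finite measure on gradient configurations is determined by its values on the cylinder sets
over large balls. -/
theorem measure_ext_of_cyl (hG : G.IsTree) {ρ : V} {μ ν : Measure (GradConf G ρ)}
    [IsFiniteMeasure ν] (N : ℕ)
    (h : ∀ n, N ≤ n → ∀ ζ, μ (cyl (ball G ρ n) ζ) = ν (cyl (ball G ρ n) ζ)) : μ = ν := by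
  classical
  refine IsProjectiveLimit.unique (P := fun I => ν.map I.restrict) (fun I => ?_) (fun I => rfl)
  obtain ⟨n, hNn, hn⟩ : ∃ n, N ≤ n ∧ (I.image fun b => b.1.1) ⊆ ball G ρ n := by
    obtain ⟨m, hm⟩ := exists_subset_ball hG ρ (I.image fun b => b.1.1)
    exact ⟨max N m, le_max_left _ _, hm.trans (ball_mono ρ (le_max_right _ _))⟩
  have hI : ∀ b ∈ I, b ∈ edgesMeeting G ρ (ball G ρ n) := fun b hb =>
    (mem_edgesMeeting _ _ _ _).2 (Or.inl (hn (Finset.mem_image_of_mem _ hb)))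
  let f : (edgesMeeting G ρ (ball G ρ n) → ℤ) → (I → ℤ) := fun e b => e ⟨b.1, hI b.1 b.2⟩
  have hf : Measurable f := by fun_prop
  have hcomp : (I.restrict : GradConf G ρ → I → ℤ) = f ∘ restr (ball G ρ n) := rfl
  -- The space of restrictions is countable, so its measures are determined by singletons, that is,
  -- by cylinders.
  have hmap : μ.map (restr (ball G ρ n)) = ν.map (restr (ball G ρ n)) :=
    Measure.ext_of_singleton fun e => by rw [map_restr_singleton, map_restr_singleton, h n hNn]
  calc μ.map I.restrict = (μ.map (restr (ball G ρ n))).map f := by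
        rw [Measure.map_map hf (measurable_restr _), hcomp]
    _ = ν.map I.restrict := by rw [hmap, Measure.map_map hf (measurable_restr _), hcomp]

/-- The unnormalised weight of a height configuration in the marginal on the edges meeting `Λ`. -/
def weight (G : SimpleGraph V) [G.LocallyFinite] (ρ : V) (β : ℝ) (q : ℕ) (l : ℤ → ℝ)
    (Λ : Finset V) (ω : V → ℤ) : ℝ :=
  (∑ s ∈ Finset.range q, ∏ y ∈ outerBoundary G Λ, l ((s : ℤ) + ω y)) *
    ∏ b ∈ edgesMeeting G ρ Λ, Q β (grad G ρ ω b)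

/-- The marginal of `ν` on the edges meeting `Λ` is proportional to `weight`. -/
def Marg {ρ : V} (β : ℝ) (q : ℕ) (l : ℤ → ℝ) (ν : Measure (GradConf G ρ)) (Λ : Finset V) : Prop :=
  ∃ Z : ℝ, 0 < Z ∧ ∀ ω : V → ℤ,
    ν (cyl Λ (grad G ρ ω)) = ENNReal.ofReal (Z * weight G ρ β q l Λ ω)

theorem sum_range_shift {q : ℕ} {f : ℤ → ℝ} (hf : ∀ n, f (n + q) = f n) (t : ℤ) :
    ∑ s ∈ Finset.range q, f ((s : ℤ) + t) = ∑ s ∈ Finset.range q, f s := by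
  have h1 : ∀ t : ℤ, ∑ s ∈ Finset.range q, f ((s : ℤ) + (t + 1)) =
      ∑ s ∈ Finset.range q, f ((s : ℤ) + t) := by
    intro t
    have h := (Finset.sum_range_succ (fun s : ℕ => f ((s : ℤ) + t)) q).symm.trans
      (Finset.sum_range_succ' (fun s : ℕ => f ((s : ℤ) + t)) q)
    have h2 : f ((q : ℤ) + t) = f (((0 : ℕ) : ℤ) + t) := by
      rw [add_comm, hf]; simp
    rw [h2] at h
    have h3 := add_right_cancel h
    rw [h3]
    refine Finset.sum_congr rfl fun s _ => ?_
    push_cast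
    congr 1
    ring
  induction t using Int.induction_on with
  | zero => simp
  | succ i ih => rw [h1, ih]
  | pred i ih =>
    rw [← ih, ← h1 (-(i : ℤ) - 1)]
    simp

/-- Because `s` runs over a full period, a common shift of all heights only permutes the summands.
The weight of a marginal thus depends on the gradients alone. -/
theorem sum_prod_shift {q : ℕ} {l : ℤ → ℝ} (hl : ∀ n, l (n + q) = l n) (S : Finset V)
    (ω : V → ℤ) (t : ℤ) :
    ∑ s ∈ Finset.range q, ∏ y ∈ S, l ((s : ℤ) + (ω y + t)) =
      ∑ s ∈ Finset.range q, ∏ y ∈ S, l ((s : ℤ) + ω y) := by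
  have := sum_range_shift (q := q) (f := fun n => ∏ y ∈ S, l (n + ω y)) (fun n =>
    Finset.prod_congr rfl fun y _ => by rw [add_right_comm, hl]) t
  rw [← this]
  refine Finset.sum_congr rfl fun s _ => Finset.prod_congr rfl fun y _ => ?_
  congr 1; ring

theorem Conn.setOf_eq_cyl (hG : G.IsTree) {ρ : V} {Λ : Finset V} (h : Conn G Λ) (ζ : GradConf G ρ) :
    {η | ∀ b : OEdge G ρ, b.1.1 ∈ closureOf G Λ → b.1.2 ∈ closureOf G Λ → η b = ζ b} =
      cyl Λ ζ := by
  ext η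
  simp only [cyl, Set.mem_ofPred_eq, h.mem_edgesMeeting_iff hG, and_imp]

/-- Every gradient configuration comes from heights, path sums are height differences, and the shift
by the height at `w` disappears in the periodic sum. The base point can therefore be dropped. -/
theorem hasMarginals_iff (hG : G.IsTree) {ρ : V} {β : ℝ} {q : ℕ} {l : ℤ → ℝ}
    (hl : ∀ n, l (n + q) = l n) (ν : Measure (GradConf G ρ)) :
    HasMarginals hG ρ β q l ν ↔ ∀ Λ, Conn G Λ → Marg β q l ν Λ := by
  refine forall₂_congr fun Λ hΛ => ?_
  refine exists_congr fun Z => and_congr_right fun _ => ?_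
  have key : ∀ w (ω : V → ℤ),
      ∑ s ∈ Finset.range q, ∏ y ∈ outerBoundary G Λ,
        l ((s : ℤ) + pathSum hG (grad G ρ ω) w y) =
      ∑ s ∈ Finset.range q, ∏ y ∈ outerBoundary G Λ, l ((s : ℤ) + ω y) := by
    intro w ω
    rw [← sum_prod_shift hl _ ω (-ω w)]
    refine Finset.sum_congr rfl fun s _ => Finset.prod_congr rfl fun y _ => ?_
    rw [pathSum_grad, sub_eq_add_neg]
  constructor
  · intro H ω
    obtain ⟨w, hw⟩ := hΛ.nonempty
    have := H w hw (grad G ρ ω)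
    rw [Conn.setOf_eq_cyl hG hΛ, key] at this
    rw [this, weight, mul_assoc]
  · intro H w _ ζ
    have := H (heights hG ζ)
    have hk := key w (heights hG ζ)
    rw [grad_heights] at this hk
    rw [Conn.setOf_eq_cyl hG hΛ, this, weight, hk, mul_assoc, grad_heights]

/-- The convolution of `l` with the transfer operator. -/
def conv (β : ℝ) (l : ℤ → ℝ) (i : ℤ) : ℝ := ∑' j : ℤ, Q β (i - j) * l j

theorem Q_neg (β : ℝ) (m : ℤ) : Q β (-m) = Q β m := by simp [Q]

theorem Q_pos (β : ℝ) (m : ℤ) : 0 < Q β m := Real.exp_pos _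

theorem IsBoundaryLaw.hasSum {β : ℝ} {k : ℕ} {l : ℤ → ℝ} (h : IsBoundaryLaw β k l) (i s : ℤ) :
    HasSum (fun j => Q β (j - i) * l (s + j)) (conv β l (s + i)) := by
  have := (h.2.1 (s + i)).hasSum
  rw [← (Equiv.addLeft s).hasSum_iff] at this
  refine this.congr_fun fun j => ?_
  simp only [Function.comp, Equiv.coe_addLeft]
  rw [← Q_neg]
  congr 2
  ring

theorem IsBoundaryLaw.conv_pos {β : ℝ} {k : ℕ} {l : ℤ → ℝ} (h : IsBoundaryLaw β k l) (i : ℤ) :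
    0 < conv β l i :=
  (h.2.1 i).tsum_pos (fun j => (mul_pos (Q_pos _ _) (h.1 j)).le) i (mul_pos (Q_pos _ _) (h.1 i))

theorem Q_grad_edge {V : Type*} {G : SimpleGraph V} {ρ : V} {β : ℝ} {e : OEdge G ρ} {x y : V} (h : e.1 = (x, y) ∨ e.1 = (y, x))
    (ω : V → ℤ) : Q β (grad G ρ ω e) = Q β (ω y - ω x) := by
  rcases h with h | h
  · simp [grad, h]
  · rw [← Q_neg]; simp [grad, h]

section Step

variable {ρ : V} {Λ : Finset V} {v v₁ v₂ : V} {e₁ e₂ : OEdge G ρ}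

open Classical in
/-- Change the heights at two vertices. -/
def setTwo (v₁ v₂ : V) (ω : V → ℤ) (k : ℤ × ℤ) : V → ℤ :=
  Function.update (Function.update ω v₁ k.1) v₂ k.2

theorem setTwo_fst (h : v₁ ≠ v₂) (ω : V → ℤ) (k : ℤ × ℤ) : setTwo v₁ v₂ ω k v₁ = k.1 := by
  simp [setTwo, h]

theorem setTwo_snd (ω : V → ℤ) (k : ℤ × ℤ) : setTwo v₁ v₂ ω k v₂ = k.2 := by
  simp [setTwo]

theorem setTwo_of_ne (ω : V → ℤ) (k : ℤ × ℤ) {x : V} (h₁ : x ≠ v₁) (h₂ : x ≠ v₂) :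
    setTwo v₁ v₂ ω k x = ω x := by
  simp [setTwo, h₁, h₂]

theorem Extension.grad_setTwo (hG : G.IsTree) (hΛ : Conn G Λ) (E : Extension ρ Λ v v₁ v₂ e₁ e₂)
    (ω : V → ℤ) (k : ℤ × ℤ) {b : OEdge G ρ} (hb : b ∈ edgesMeeting G ρ Λ) :
    grad G ρ (setTwo v₁ v₂ ω k) b = grad G ρ ω b := by
  obtain ⟨h1, h2⟩ := (hΛ.mem_edgesMeeting_iff hG b).1 hb
  have hne : ∀ x ∈ closureOf G Λ, setTwo v₁ v₂ ω k x = ω x := fun x hx =>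
    setTwo_of_ne ω k (fun H => E.notMem₁ (H ▸ hx)) (fun H => E.notMem₂ (H ▸ hx))
  simp only [grad, hne _ h1, hne _ h2]

theorem Extension.mem_closure (E : Extension ρ Λ v v₁ v₂ e₁ e₂) : v ∈ closureOf G Λ := by
  have := mem_outerBoundary.1 E.mem
  exact mem_closureOf.2 (Or.inr this.1)

-- The values on the two new edges correspond bijectively to the heights at `v₁` and `v₂`, since the
-- height at `v` is kept.
open Classical in
theorem Extension.cyl_eq_iUnion (hG : G.IsTree) (hΛ : Conn G Λ)
    (E : Extension ρ Λ v v₁ v₂ e₁ e₂) (ω : V → ℤ) :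
    cyl Λ (grad G ρ ω) = ⋃ k : ℤ × ℤ, cyl (insert v Λ) (grad G ρ (setTwo v₁ v₂ ω k)) := by
  have hv : ∀ k, setTwo v₁ v₂ ω k v = ω v := fun k => setTwo_of_ne ω k E.adj₁.ne E.adj₂.ne
  ext η
  simp only [Set.mem_iUnion, cyl, Set.mem_ofPred_eq, E.edges, Finset.forall_mem_insert]
  constructor
  · intro H
    obtain ⟨k₁, hk₁⟩ : ∃ k₁, ∀ k₂, η e₁ = grad G ρ (setTwo v₁ v₂ ω (k₁, k₂)) e₁ := by
      rcases E.edge₁ with h | h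
      · exact ⟨ω v + η e₁, fun k₂ => by simp [grad, h, hv, setTwo_fst E.ne]⟩
      · exact ⟨ω v - η e₁, fun k₂ => by simp [grad, h, hv, setTwo_fst E.ne]⟩
    obtain ⟨k₂, hk₂⟩ : ∃ k₂, ∀ k₁, η e₂ = grad G ρ (setTwo v₁ v₂ ω (k₁, k₂)) e₂ := by
      rcases E.edge₂ with h | h
      · exact ⟨ω v + η e₂, fun k₂ => by simp [grad, h, hv, setTwo_snd]⟩
      · exact ⟨ω v - η e₂, fun k₂ => by simp [grad, h, hv, setTwo_snd]⟩
    exact ⟨(k₁, k₂), hk₁ k₂, hk₂ k₁, fun b hb => by rw [H b hb, E.grad_setTwo hG hΛ ω _ hb]⟩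
  · rintro ⟨k, -, -, H⟩ b hb
    rw [H b hb, E.grad_setTwo hG hΛ ω _ hb]

open Classical in
theorem Extension.pairwise_disjoint_cyl (E : Extension ρ Λ v v₁ v₂ e₁ e₂) (ω : V → ℤ) :
    Pairwise (Function.onFun Disjoint fun k : ℤ × ℤ =>
      cyl (insert v Λ) (grad G ρ (setTwo v₁ v₂ ω k))) := by
  have hv : ∀ k, setTwo v₁ v₂ ω k v = ω v := fun k => setTwo_of_ne ω k E.adj₁.ne E.adj₂.ne
  intro k k' hk
  refine Set.disjoint_left.2 fun η h h' => hk ?_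
  simp only [cyl, Set.mem_ofPred_eq, E.edges, Finset.forall_mem_insert] at h h'
  have h1 := h.1.symm.trans h'.1
  have h2 := h.2.1.symm.trans h'.2.1
  refine Prod.ext ?_ ?_
  · rcases E.edge₁ with h | h <;> simpa [grad, h, hv, setTwo_fst E.ne] using h1
  · rcases E.edge₂ with h | h <;> simpa [grad, h, hv, setTwo_snd] using h2

open Classical in
theorem Extension.prod_boundary (E : Extension ρ Λ v v₁ v₂ e₁ e₂) (f : V → ℝ) :
    ∏ y ∈ outerBoundary G (insert v Λ), f y =
      f v₁ * (f v₂ * ∏ y ∈ (outerBoundary G Λ).erase v, f y) := by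
  have h₁ : v₁ ∉ outerBoundary G Λ := fun H =>
    E.notMem₁ (mem_closureOf.2 (Or.inr (mem_outerBoundary.1 H).1))
  have h₂ : v₂ ∉ outerBoundary G Λ := fun H =>
    E.notMem₂ (mem_closureOf.2 (Or.inr (mem_outerBoundary.1 H).1))
  rw [E.boundary, Finset.prod_insert, Finset.prod_insert]
  · simp [h₂]
  · simp [h₁, E.ne]

open Classical in
theorem Extension.prod_edges (E : Extension ρ Λ v v₁ v₂ e₁ e₂) (f : OEdge G ρ → ℝ) :
    ∏ b ∈ edgesMeeting G ρ (insert v Λ), f b =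
      f e₁ * (f e₂ * ∏ b ∈ edgesMeeting G ρ Λ, f b) := by
  rw [E.edges, Finset.prod_insert, Finset.prod_insert E.edge_notMem₂]
  simp [E.edge_notMem₁, E.edge_ne]

-- Summing out the heights of the two new leaves gives the square of `conv β l` at the height of
-- `v`, which is `l` there divided by `c`. This is where the boundary law equation, with exponent 2
-- for the binary tree, makes the marginals consistent.
open Classical in
theorem Extension.hasSum_weight (hG : G.IsTree) (hΛ : Conn G Λ)
    (E : Extension ρ Λ v v₁ v₂ e₁ e₂) {β : ℝ} {q : ℕ} {l : ℤ → ℝ} (hl : IsBoundaryLaw β 2 l)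
    {c : ℝ} (hc : 0 < c) (hlc : ∀ i, l i = c * conv β l i ^ 2) (ω : V → ℤ) :
    HasSum (fun k => weight G ρ β q l (insert v Λ) (setTwo v₁ v₂ ω k))
      (c⁻¹ * weight G ρ β q l Λ ω) := by
  have hv : ∀ k, setTwo v₁ v₂ ω k v = ω v := fun k => setTwo_of_ne ω k E.adj₁.ne E.adj₂.ne
  have hbd : ∀ k, ∀ y ∈ (outerBoundary G Λ).erase v, setTwo v₁ v₂ ω k y = ω y := by
    intro k y hy
    have hy' : y ∈ closureOf G Λ :=
      mem_closureOf.2 (Or.inr (mem_outerBoundary.1 (Finset.mem_of_mem_erase hy)).1)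
    exact setTwo_of_ne ω k (fun H => E.notMem₁ (H ▸ hy')) (fun H => E.notMem₂ (H ▸ hy'))
  set A : ℝ := ∏ b ∈ edgesMeeting G ρ Λ, Q β (grad G ρ ω b) with hA
  set B : ℕ → ℝ := fun s => ∏ y ∈ (outerBoundary G Λ).erase v, l ((s : ℤ) + ω y) with hB
  have hsq : ∀ s : ℕ, HasSum (fun k : ℤ × ℤ =>
      (Q β (k.1 - ω v) * l (s + k.1)) * (Q β (k.2 - ω v) * l (s + k.2)))
      (conv β l (s + ω v) * conv β l (s + ω v)) := by
    intro s
    have h := hl.hasSum (ω v) s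
    have h0 : ∀ j, 0 ≤ Q β (j - ω v) * l (s + j) := fun j =>
      (mul_pos (Q_pos _ _) (hl.1 _)).le
    exact h.mul h (h.summable.mul_of_nonneg h.summable h0 h0)
  have hsum : HasSum (fun k : ℤ × ℤ => (∑ s ∈ Finset.range q,
      B s * ((Q β (k.1 - ω v) * l (s + k.1)) * (Q β (k.2 - ω v) * l (s + k.2)))) * A)
      ((∑ s ∈ Finset.range q, B s * (conv β l (s + ω v) * conv β l (s + ω v))) * A) :=
    (hasSum_sum fun s _ => (hsq s).mul_left (B s)).mul_right A
  convert hsum using 1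
  · funext k
    rw [weight, E.prod_edges, Q_grad_edge E.edge₁, Q_grad_edge E.edge₂, hv, setTwo_fst E.ne,
      setTwo_snd, Finset.prod_congr rfl fun b hb => by rw [E.grad_setTwo hG hΛ ω k hb], ← hA,
      Finset.sum_mul, Finset.sum_mul]
    refine Finset.sum_congr rfl fun s _ => ?_
    rw [E.prod_boundary, setTwo_fst E.ne, setTwo_snd,
      Finset.prod_congr rfl fun y hy => by rw [hbd k y hy]]
    simp only [hB]
    ring
  · rw [weight, ← hA, ← mul_assoc, Finset.mul_sum]
    congr 1
    refine Finset.sum_congr rfl fun s _ => ?_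
    rw [← Finset.mul_prod_erase _ _ E.mem, hlc]
    simp only [hB]
    field_simp

open Classical in
theorem Extension.marg (hG : G.IsTree) (hΛ : Conn G Λ) (E : Extension ρ Λ v v₁ v₂ e₁ e₂) {β : ℝ}
    {q : ℕ} {l : ℤ → ℝ} (hl : IsBoundaryLaw β 2 l) {ν : Measure (GradConf G ρ)}
    (h : Marg β q l ν (insert v Λ)) : Marg β q l ν Λ := by
  obtain ⟨c, hc, hlc⟩ := hl.2.2
  obtain ⟨Z, hZ, H⟩ := h
  refine ⟨Z * c⁻¹, by positivity, fun ω => ?_⟩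
  have hs := (E.hasSum_weight hG hΛ (q := q) hl hc hlc ω).mul_left Z
  rw [E.cyl_eq_iUnion hG hΛ, measure_iUnion (E.pairwise_disjoint_cyl ω)
    fun k => measurableSet_cyl _ _]
  simp only [H]
  rw [← ENNReal.ofReal_tsum_of_nonneg _ hs.summable, hs.tsum_eq, mul_assoc]
  intro k
  refine mul_nonneg hZ.le (mul_nonneg (Finset.sum_nonneg fun s _ => ?_) ?_)
  · exact Finset.prod_nonneg fun y _ => (hl.1 _).le
  · exact Finset.prod_nonneg fun y _ => (Q_pos _ _).le

end Step

/-- The marginals on connected sets containing the root determine all other marginals. -/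
theorem hasMarginals_of_root (hG : G.IsTree) (hdeg : G.IsRegularOfDegree 3) {ρ : V} {β : ℝ} {q : ℕ}
    {l : ℤ → ℝ} (hper : ∀ n, l (n + q) = l n) (hl : IsBoundaryLaw β 2 l)
    {ν : Measure (GradConf G ρ)} (h : ∀ Λ, Conn G Λ → ρ ∈ Λ → Marg β q l ν Λ) :
    HasMarginals hG ρ β q l ν := by
  rw [hasMarginals_iff hG hper]
  intro Λ hΛ
  obtain ⟨n, hn⟩ := exists_subset_ball hG ρ Λ
  -- Marginals pass from larger sets to smaller ones, so the property carried along the growth is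
  -- the implication down to the fixed `Λ`.
  refine Conn.growth (P := fun Λ' => Marg β q l ν Λ' → Marg β q l ν Λ) hΛ (conn_ball ρ n) hn id
    (fun Λ' u v _ hc hu hv huv ih hm => ?_) (h _ (conn_ball ρ n) (root_mem_ball ρ n))
  obtain ⟨v₁, v₂, e₁, e₂, E⟩ := hc.exists_extension hG hdeg ρ hu hv huv
  exact ih (E.marg hG hc hl hm)

end Marginals

/-! ### Existence: a Markov chain of heights indexed by the tree -/

section Construction

variable {V : Type*} {G : SimpleGraph V}

/-- The law of the height increment along an edge that starts at height `k`. -/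
def stepPMF {β : ℝ} {l : ℤ → ℝ} (hl : IsBoundaryLaw β 2 l) (k : ℤ) : PMF ℤ :=
  ⟨fun j => ENNReal.ofReal (Q β j * l (k + j) / conv β l k), by
    have h : HasSum (fun j => Q β j * l (k + j) / conv β l k) 1 := by
      have := (hl.hasSum 0 k).div_const (conv β l k)
      simpa [(hl.conv_pos k).ne'] using this
    have h0 : ∀ j, 0 ≤ Q β j * l (k + j) / conv β l k := fun j =>
      div_nonneg (mul_pos (Q_pos _ _) (hl.1 _)).le (hl.conv_pos k).le
    rw [ENNReal.summable.hasSum_iff, ← ENNReal.ofReal_tsum_of_nonneg h0 h.summable, h.tsum_eq,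
      ENNReal.ofReal_one]⟩

/-- The law of independent height increments, one for each vertex and each height of its parent. -/
def incrementLaw (V : Type*) {β : ℝ} {l : ℤ → ℝ} (hl : IsBoundaryLaw β 2 l) :
    Measure (V × ℤ → ℤ) :=
  Measure.infinitePi fun i => (stepPMF hl i.2).toMeasure

instance {β : ℝ} {l : ℤ → ℝ} (hl : IsBoundaryLaw β 2 l) :
    IsProbabilityMeasure (incrementLaw V hl) := by
  unfold incrementLaw; infer_instance

/-- The path between two vertices of a tree. -/
def treePath (hG : G.IsTree) (x y : V) : G.Walk x y := (hG.existsUnique_path x y).choose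

theorem treePath_eq (hG : G.IsTree) {x y : V} {p : G.Walk x y} (hp : p.IsPath) :
    treePath hG x y = p :=
  path_eq hG (hG.existsUnique_path x y).choose_spec.1 hp

/-- The height configuration with height `s` at the root whose increment from the parent of `y` to
`y` is `U (y, k)`, where `k` is the height of the parent. -/
def chainHeights (hG : G.IsTree) (ρ : V) (s : ℤ) (U : V × ℤ → ℤ) (y : V) : ℤ :=
  ((treePath hG ρ y).support.tail).foldl (fun k x => k + U (x, k)) s

theorem chainHeights_root (hG : G.IsTree) (ρ : V) (s : ℤ) (U : V × ℤ → ℤ) :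
    chainHeights hG ρ s U ρ = s := by
  simp [chainHeights, treePath_eq hG (SimpleGraph.Walk.IsPath.nil (u := ρ))]

theorem chainHeights_snd (hG : G.IsTree) {ρ : V} (s : ℤ) (U : V × ℤ → ℤ) (b : OEdge G ρ) :
    chainHeights hG ρ s U b.1.2 =
      chainHeights hG ρ s U b.1.1 + U (b.1.2, chainHeights hG ρ s U b.1.1) := by
  obtain ⟨⟨x, y⟩, h⟩ := b
  obtain ⟨p, hp, -⟩ := hG.existsUnique_path ρ x
  have hq : (p.concat (show G.Adj x y from h.1)).IsPath := h.concat_isPath hG hp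
  simp only [chainHeights]
  rw [treePath_eq hG hp, treePath_eq hG hq, SimpleGraph.Walk.support_concat,
    List.tail_append_of_ne_nil (SimpleGraph.Walk.support_ne_nil _), List.foldl_append]
  rfl

/-- The coordinate that is read depends on `U` itself; this is harmless because the index ranges
over the countable set ℤ. -/
theorem measurable_eval_countable {ι : Type*} (x : ι) {f : (ι × ℤ → ℤ) → ℤ} (hf : Measurable f) :
    Measurable fun U : ι × ℤ → ℤ => U (x, f U) := by
  have h : Measurable fun p : (ι × ℤ → ℤ) × ℤ => p.1 (x, p.2) :=
    measurable_from_prod_countable_left fun k => measurable_pi_apply (x, k)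
  exact h.comp (measurable_id.prodMk hf)

theorem measurable_chainHeights (hG : G.IsTree) (ρ : V) (s : ℤ) (y : V) :
    Measurable fun U => chainHeights hG ρ s U y := by
  have H : ∀ (L : List V) (f : (V × ℤ → ℤ) → ℤ), Measurable f →
      Measurable fun U => L.foldl (fun k x => k + U (x, k)) (f U) := by
    intro L
    induction L with
    | nil => intro f hf; exact hf
    | cons x L ih =>
      intro f hf
      exact ih (fun U => f U + U (x, f U)) (hf.add (measurable_eval_countable x hf))
  exact H _ (fun _ => s) measurable_const

theorem measurable_grad (G : SimpleGraph V) (ρ : V) : Measurable (grad G ρ) :=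
  measurable_pi_lambda _ fun b => (measurable_pi_apply b.1.2).sub (measurable_pi_apply b.1.1)

/-- The law of the gradients of the chain that starts at height `s` at the root. -/
def chainLaw (hG : G.IsTree) (ρ : V) {β : ℝ} {l : ℤ → ℝ} (hl : IsBoundaryLaw β 2 l) (s : ℤ) :
    Measure (GradConf G ρ) :=
  (incrementLaw V hl).map fun U => grad G ρ (chainHeights hG ρ s U)

theorem measurable_grad_chainHeights (hG : G.IsTree) (ρ : V) (s : ℤ) :
    Measurable fun U => grad G ρ (chainHeights hG ρ s U) :=
  (measurable_grad G ρ).comp (measurable_pi_lambda _ fun y => measurable_chainHeights hG ρ s y)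

instance (hG : G.IsTree) (ρ : V) {β : ℝ} {l : ℤ → ℝ} (hl : IsBoundaryLaw β 2 l) (s : ℤ) :
    IsProbabilityMeasure (chainLaw hG ρ hl s) :=
  Measure.isProbabilityMeasure_map (measurable_grad_chainHeights hG ρ s).aemeasurable

/-- The gradient measure of a `q`-periodic boundary law. -/
def boundaryLawMeasure (hG : G.IsTree) (ρ : V) {β : ℝ} (q : ℕ) {l : ℤ → ℝ}
    (hl : IsBoundaryLaw β 2 l) : Measure (GradConf G ρ) :=
  ∑ s ∈ Finset.range q, ENNReal.ofReal
    (conv β l s ^ 3 / ∑ t ∈ Finset.range q, conv β l t ^ 3) • chainLaw hG ρ hl s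

theorem sum_conv_pos {β : ℝ} {q : ℕ} (hq : 0 < q) {l : ℤ → ℝ} (hl : IsBoundaryLaw β 2 l) :
    0 < ∑ t ∈ Finset.range q, conv β l t ^ 3 :=
  Finset.sum_pos (fun t _ => pow_pos (hl.conv_pos _) 3) ⟨0, by simpa using hq⟩

theorem isProbabilityMeasure_boundaryLawMeasure (hG : G.IsTree) (ρ : V) {β : ℝ} {q : ℕ}
    (hq : 0 < q) {l : ℤ → ℝ} (hl : IsBoundaryLaw β 2 l) :
    IsProbabilityMeasure (boundaryLawMeasure hG ρ q hl) := by
  constructor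
  have hN := sum_conv_pos hq hl
  simp only [boundaryLawMeasure, Measure.coe_finsetSum, Finset.sum_apply, Measure.smul_apply,
    measure_univ, smul_eq_mul, mul_one]
  rw [← ENNReal.ofReal_sum_of_nonneg, ← Finset.sum_div, div_self hN.ne', ENNReal.ofReal_one]
  intro s _
  exact div_nonneg (pow_pos (hl.conv_pos _) 3).le hN.le

variable [G.LocallyFinite]

theorem Extension.oriented (hG : G.IsTree) {ρ : V} {Λ : Finset V} {v v₁ v₂ : V} {e₁ e₂ : OEdge G ρ}
    (E : Extension ρ Λ v v₁ v₂ e₁ e₂) (hΛ : Conn G Λ) (hρ : ρ ∈ Λ) :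
    e₁.1 = (v, v₁) ∧ e₂.1 = (v, v₂) := by
  classical
  obtain ⟨⟨u, hu, huv⟩, -⟩ := mem_outerBoundary.1 E.mem
  have hc := hΛ.insert_adj hu huv
  have H : ∀ y (e : OEdge G ρ), G.Adj v y → y ∉ closureOf G Λ → (e.1 = (v, y) ∨ e.1 = (y, v)) →
      e.1 = (v, y) := by
    intro y e hvy hy he
    have ho : Oriented G ρ (v, y) := Conn.oriented hG hc (by simp [hρ]) (by simp)
      (by simp only [Finset.mem_insert, not_or]
          exact ⟨hvy.ne', fun h => hy (subset_closureOf _ h)⟩) hvy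
    refine he.resolve_right fun h => ho.not_symm (h ▸ e.2)
  exact ⟨H _ _ E.adj₁ E.notMem₁ E.edge₁, H _ _ E.adj₂ E.notMem₂ E.edge₂⟩

theorem Conn.chainHeights_eq (hG : G.IsTree) (hdeg : G.IsRegularOfDegree 3) {ρ : V} {Λ : Finset V}
    (hΛ : Conn G Λ) (hρ : ρ ∈ Λ) {ω : V → ℤ} {U : V × ℤ → ℤ}
    (hU : ∀ b ∈ edgesMeeting G ρ Λ, U (b.1.2, ω b.1.1) = grad G ρ ω b) :
    ∀ x ∈ closureOf G Λ, chainHeights hG ρ (ω ρ) U x = ω x := by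
  classical
  have key : ∀ b : OEdge G ρ, U (b.1.2, ω b.1.1) = grad G ρ ω b →
      chainHeights hG ρ (ω ρ) U b.1.1 = ω b.1.1 → chainHeights hG ρ (ω ρ) U b.1.2 = ω b.1.2 := by
    intro b h1 h2
    rw [chainHeights_snd, h2, h1]
    simp [grad]
  refine Conn.growth (conn_singleton ρ) hΛ (by simpa using hρ)
    (P := fun Λ => (∀ b ∈ edgesMeeting G ρ Λ, U (b.1.2, ω b.1.1) = grad G ρ ω b) →
      ∀ x ∈ closureOf G Λ, chainHeights hG ρ (ω ρ) U x = ω x) ?_ ?_ hU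
  · intro h x hx
    rcases mem_closureOf.1 hx with hx | ⟨y, hy, hyx⟩
    · rw [Finset.mem_singleton.1 hx, chainHeights_root]
    · rw [Finset.mem_singleton] at hy
      subst hy
      have ho : Oriented G y (y, x) := Conn.oriented hG (conn_singleton y) (by simp) (by simp)
        (by simpa using hyx.ne') hyx
      exact key ⟨_, ho⟩ (h _ ((mem_edgesMeeting _ _ _ _).2 (by simp))) (chainHeights_root _ _ _ _)
  · intro Λ u v hΛ hc hu hv huv ih h
    have hρ' : ρ ∈ Λ := hΛ (by simp)
    obtain ⟨v₁, v₂, e₁, e₂, E⟩ := hc.exists_extension hG hdeg ρ hu hv huv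
    obtain ⟨h1, h2⟩ := E.oriented hG hc hρ'
    rw [E.edges] at h
    simp only [Finset.forall_mem_insert] at h
    have ih' := ih h.2.2
    have hv' := ih' v E.mem_closure
    intro x hx
    rw [E.closure, Finset.mem_insert, Finset.mem_insert] at hx
    rcases hx with rfl | rfl | hx
    · have := key e₁ h.1 (by rw [h1]; exact hv')
      rwa [h1] at this
    · have := key e₂ h.2.1 (by rw [h2]; exact hv')
      rwa [h2] at this
    · exact ih' x hx

/-- Once the heights are known to follow `ω`, only the increments at the parent heights given by `ω`
are used. The cylinder thus becomes an event on finitely many fixed coordinates of `U`. -/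
theorem Conn.preimage_cyl (hG : G.IsTree) (hdeg : G.IsRegularOfDegree 3) {ρ : V} {Λ : Finset V}
    (hΛ : Conn G Λ) (hρ : ρ ∈ Λ) (ω : V → ℤ) :
    (fun U => grad G ρ (chainHeights hG ρ (ω ρ) U)) ⁻¹' cyl Λ (grad G ρ ω) =
      {U | ∀ b ∈ edgesMeeting G ρ Λ, U (b.1.2, ω b.1.1) = grad G ρ ω b} := by
  ext U
  have hstep : ∀ b : OEdge G ρ, chainHeights hG ρ (ω ρ) U b.1.1 = ω b.1.1 →
      grad G ρ (chainHeights hG ρ (ω ρ) U) b = U (b.1.2, ω b.1.1) := by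
    intro b h
    simp only [grad]
    rw [chainHeights_snd, h]
    simp
  constructor
  · intro H b hb
    have hb' : b.1.1 ∈ closureOf G Λ := ((hΛ.mem_edgesMeeting_iff hG b).1 hb).1
    have := Conn.exists_shift hG hΛ (ω := ω) (ω' := chainHeights hG ρ (ω ρ) U)
      (fun b hb => (H b hb).symm) (subset_closureOf _ hρ) hb'
    rw [chainHeights_root] at this
    rw [← hstep b (by omega)]
    exact H b hb
  · intro H b hb
    have hb' : b.1.1 ∈ closureOf G Λ := ((hΛ.mem_edgesMeeting_iff hG b).1 hb).1
    exact (hstep b (Conn.chainHeights_eq hG hdeg hΛ hρ H _ hb')).trans (H b hb)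

theorem Conn.chainLaw_cyl (hG : G.IsTree) (hdeg : G.IsRegularOfDegree 3) {ρ : V} {Λ : Finset V}
    (hΛ : Conn G Λ) (hρ : ρ ∈ Λ) {β : ℝ} {l : ℤ → ℝ} (hl : IsBoundaryLaw β 2 l) (ω : V → ℤ) :
    chainLaw hG ρ hl (ω ρ) (cyl Λ (grad G ρ ω)) = ENNReal.ofReal
      (∏ b ∈ edgesMeeting G ρ Λ, Q β (grad G ρ ω b) * (l (ω b.1.2) / conv β l (ω b.1.1))) := by
  classical
  rw [chainLaw, Measure.map_apply (measurable_grad_chainHeights hG ρ _) (measurableSet_cyl _ _),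
    Conn.preimage_cyl hG hdeg hΛ hρ]
  let f : OEdge G ρ → V × ℤ := fun b => (b.1.2, ω b.1.1)
  -- Each vertex has only one parent, so different edges read different, hence independent,
  -- coordinates.
  have hf : Function.Injective f := by
    rintro ⟨⟨x, y⟩, h⟩ ⟨⟨x', y'⟩, h'⟩ H
    obtain rfl : y = y' := congrArg Prod.fst H
    obtain rfl := h.fst_unique hG h'
    rfl
  have hset : {U : V × ℤ → ℤ | ∀ b ∈ edgesMeeting G ρ Λ, U (b.1.2, ω b.1.1) = grad G ρ ω b} =
      Set.pi ((edgesMeeting G ρ Λ).image f : Finset (V × ℤ)) fun i => {ω i.1 - i.2} := by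
    ext U
    simp only [Set.mem_ofPred_eq, Set.mem_pi, Finset.mem_coe, Finset.forall_mem_image]
    rfl
  rw [hset, incrementLaw, Measure.infinitePi_pi _ fun i _ => measurableSet_singleton _,
    Finset.prod_image fun x _ y _ h => hf h, ENNReal.ofReal_prod_of_nonneg]
  · refine Finset.prod_congr rfl fun b _ => ?_
    rw [PMF.toMeasure_apply_singleton _ _ (measurableSet_singleton _)]
    change ENNReal.ofReal (Q β (ω b.1.2 - ω b.1.1) * l (ω b.1.1 + (ω b.1.2 - ω b.1.1)) /
      conv β l (ω b.1.1)) = _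
    rw [add_sub_cancel, mul_div_assoc]
    rfl
  · intro b _
    exact mul_nonneg (Q_pos _ _).le (div_nonneg (hl.1 _).le (hl.conv_pos _).le)

theorem outerBoundary_singleton (w : V) : outerBoundary G {w} = G.neighborFinset w := by
  ext y
  simp only [mem_outerBoundary, Finset.mem_singleton, exists_eq_left, SimpleGraph.mem_neighborFinset]
  exact ⟨fun h => h.1, fun h => ⟨h, h.ne'⟩⟩

theorem prod_edgesMeeting_root (hG : G.IsTree) (ρ : V) (f : V → V → ℝ) :
    ∏ b ∈ edgesMeeting G ρ {ρ}, f b.1.1 b.1.2 = ∏ y ∈ outerBoundary G {ρ}, f ρ y := by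
  have ho : ∀ y, G.Adj ρ y → Oriented G ρ (ρ, y) := fun y hy =>
    Conn.oriented hG (conn_singleton ρ) (by simp) (by simp) (by simpa using hy.ne') hy
  have hfst : ∀ b ∈ edgesMeeting G ρ {ρ}, b.1.1 = ρ := by
    intro b hb
    rcases (mem_edgesMeeting _ _ _ _).1 hb with h | h
    · simpa using h
    · rw [Finset.mem_singleton] at h
      have := b.2.2
      rw [h] at this
      simp at this
  refine Finset.prod_bij (fun b _ => b.1.2) ?_ ?_ ?_ ?_
  · intro b hb
    have h : G.Adj b.1.1 b.1.2 := b.2.1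
    rw [hfst b hb] at h
    rwa [outerBoundary_singleton, SimpleGraph.mem_neighborFinset]
  · intro b hb b' hb' h
    exact Subtype.ext (Prod.ext ((hfst b hb).trans (hfst b' hb').symm) h)
  · intro y hy
    rw [outerBoundary_singleton, SimpleGraph.mem_neighborFinset] at hy
    exact ⟨⟨_, ho y hy⟩, (mem_edgesMeeting _ _ _ _).2 (by simp), rfl⟩
  · intro b hb
    rw [hfst b hb]

/-- The transition factors of the chain telescope to a product over the boundary. -/
theorem Conn.exists_prod_eq (hG : G.IsTree) (hdeg : G.IsRegularOfDegree 3) {ρ : V} {Λ : Finset V}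
    (hΛ : Conn G Λ) (hρ : ρ ∈ Λ) {β : ℝ} {l : ℤ → ℝ} (hl : IsBoundaryLaw β 2 l) :
    ∃ K : ℝ, 0 < K ∧ ∀ ω : V → ℤ,
      ∏ b ∈ edgesMeeting G ρ Λ, (l (ω b.1.2) / conv β l (ω b.1.1)) =
        K * (∏ y ∈ outerBoundary G Λ, l (ω y)) / conv β l (ω ρ) ^ 3 := by
  classical
  obtain ⟨c, hc, hlc⟩ := hl.2.2
  refine Conn.growth (conn_singleton ρ) hΛ (by simpa using hρ)
    (P := fun Λ => ∃ K : ℝ, 0 < K ∧ ∀ ω : V → ℤ,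
      ∏ b ∈ edgesMeeting G ρ Λ, (l (ω b.1.2) / conv β l (ω b.1.1)) =
        K * (∏ y ∈ outerBoundary G Λ, l (ω y)) / conv β l (ω ρ) ^ 3) ?_ ?_
  -- The three edges at the root produce the cube in the denominator.
  · refine ⟨1, one_pos, fun ω => ?_⟩
    rw [prod_edgesMeeting_root hG ρ fun x y => l (ω y) / conv β l (ω x), Finset.prod_div_distrib,
      Finset.prod_const, outerBoundary_singleton, SimpleGraph.card_neighborFinset_eq_degree, hdeg ρ,
      one_mul]
  · rintro Λ u v hΛ hcon hu hv huv ⟨K, hK, ih⟩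
    have hρ' : ρ ∈ Λ := hΛ (by simp)
    obtain ⟨v₁, v₂, e₁, e₂, E⟩ := hcon.exists_extension hG hdeg ρ hu hv huv
    obtain ⟨h1, h2⟩ := E.oriented hG hcon hρ'
    -- The two new edges divide by the square of `conv β l (ω v)`; the boundary law equation cancels
    -- it against the factor `l (ω v)` of the old boundary and leaves `c`.
    refine ⟨K * c, by positivity, fun ω => ?_⟩
    rw [E.prod_edges, E.prod_boundary, ih, h1, h2, ← Finset.mul_prod_erase _ _ E.mem]
    have h3 := hl.conv_pos (ω v)
    have h4 := hl.conv_pos (ω ρ)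
    have h5 : l (ω v) = c * conv β l (ω v) ^ 2 := hlc _
    simp only [h5]
    field_simp

theorem Conn.marg_boundaryLawMeasure (hG : G.IsTree) (hdeg : G.IsRegularOfDegree 3) {ρ : V}
    {Λ : Finset V} (hΛ : Conn G Λ) (hρ : ρ ∈ Λ) {β : ℝ} {q : ℕ} (hq : 0 < q) {l : ℤ → ℝ}
    (hper : ∀ n, l (n + q) = l n) (hl : IsBoundaryLaw β 2 l) :
    Marg β q l (boundaryLawMeasure hG ρ q hl) Λ := by
  obtain ⟨K, hK, hprod⟩ := Conn.exists_prod_eq hG hdeg hΛ hρ hl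
  have hN := sum_conv_pos hq hl
  set N := ∑ t ∈ Finset.range q, conv β l t ^ 3 with hNdef
  refine ⟨K / N, div_pos hK hN, fun ω => ?_⟩
  -- The cylinder depends only on gradients, so `ω` may be shifted to have height `s` at the root.
  have hchain : ∀ s : ℤ, chainLaw hG ρ hl s (cyl Λ (grad G ρ ω)) =
      ENNReal.ofReal ((∏ b ∈ edgesMeeting G ρ Λ, Q β (grad G ρ ω b)) *
        (K * (∏ y ∈ outerBoundary G Λ, l (s + (ω y + -ω ρ))) / conv β l s ^ 3)) := by
    intro s
    have h1 : grad G ρ ω = grad G ρ (fun x => s + (ω x + -ω ρ)) := by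
      funext b; simp only [grad]; ring
    have h2 := Conn.chainLaw_cyl hG hdeg hΛ hρ hl (fun x => s + (ω x + -ω ρ))
    rw [Finset.prod_mul_distrib, hprod fun x => s + (ω x + -ω ρ), ← h1] at h2
    simpa using h2
  simp only [boundaryLawMeasure, Measure.coe_finsetSum, Finset.sum_apply, Measure.smul_apply,
    smul_eq_mul, hchain, ← hNdef]
  have hQ : 0 ≤ ∏ b ∈ edgesMeeting G ρ Λ, Q β (grad G ρ ω b) :=
    Finset.prod_nonneg fun _ _ => (Q_pos _ _).le
  have hc := fun s : ℕ => hl.conv_pos (s : ℤ)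
  have hp : ∀ s : ℕ, 0 ≤ ∏ y ∈ outerBoundary G Λ, l ((s : ℤ) + (ω y + -ω ρ)) := fun s =>
    Finset.prod_nonneg fun _ _ => (hl.1 _).le
  -- The starting weight is chosen to cancel the cube left over at the root.
  have hterm : ∀ s : ℕ, ENNReal.ofReal (conv β l s ^ 3 / N) *
      ENNReal.ofReal ((∏ b ∈ edgesMeeting G ρ Λ, Q β (grad G ρ ω b)) *
        (K * (∏ y ∈ outerBoundary G Λ, l ((s : ℤ) + (ω y + -ω ρ))) / conv β l s ^ 3)) =
      ENNReal.ofReal (K / N * (∏ b ∈ edgesMeeting G ρ Λ, Q β (grad G ρ ω b)) *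
        ∏ y ∈ outerBoundary G Λ, l ((s : ℤ) + (ω y + -ω ρ))) := by
    intro s
    have := hc s
    rw [← ENNReal.ofReal_mul (by positivity)]
    congr 1
    field_simp
  simp only [hterm]
  rw [← ENNReal.ofReal_sum_of_nonneg, ← Finset.mul_sum, sum_prod_shift hper, weight]
  · congr 1; ring
  · intro s _
    exact mul_nonneg (mul_nonneg (by positivity) hQ) (hp s)

end Construction

/-! ### The DLR equation by detailed balance, and uniqueness -/

section Specification

variable {V : Type*} {G : SimpleGraph V}

theorem measurable_stepGrad {ρ : V} (x y : V) :
    Measurable fun ζ : GradConf G ρ => stepGrad ζ x y := by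
  unfold stepGrad
  split_ifs
  · exact measurable_pi_apply _
  · exact (measurable_pi_apply _).neg
  · exact measurable_const

theorem measurable_heights (hG : G.IsTree) (ρ : V) :
    Measurable fun ζ : GradConf G ρ => heights hG ζ := by
  refine measurable_pi_lambda _ fun y => ?_
  simp only [heights, pathSum]
  generalize (hG.existsUnique_path ρ y).choose.darts = L
  induction L with
  | nil => simp
  | cons d L ih =>
    simp only [List.map_cons, List.sum_cons]
    exact (measurable_stepGrad _ _).add ih

theorem measurable_glue (Λ : Finset V) (σ : Λ → ℤ) : Measurable (glue Λ σ) := by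
  refine measurable_pi_lambda _ fun x => ?_
  unfold glue
  split_ifs
  · exact measurable_const
  · exact measurable_pi_apply x

theorem glue_of_mem {Λ : Finset V} {x : V} (hx : x ∈ Λ) (σ : Λ → ℤ) (ω : V → ℤ) :
    glue Λ σ ω x = σ ⟨x, hx⟩ := by simp [glue, hx]

theorem glue_of_notMem {Λ : Finset V} {x : V} (hx : x ∉ Λ) (σ : Λ → ℤ) (ω : V → ℤ) :
    glue Λ σ ω x = ω x := by simp [glue, hx]

variable [G.LocallyFinite]

theorem tsum_cyl {ρ : V} (Λ : Finset V) (ν : Measure (GradConf G ρ)) [IsProbabilityMeasure ν] :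
    ∑' e, ν (cyl Λ (extendZero Λ e)) = 1 := by
  have h1 := lintegral_countable' (μ := ν.map (restr Λ)) fun _ => 1
  rw [lintegral_one, Measure.map_apply (measurable_restr _) MeasurableSet.univ, Set.preimage_univ,
    measure_univ] at h1
  simpa only [one_mul, map_restr_singleton] using h1.symm

theorem measurable_boltzmann (ρ : V) (β : ℝ) (Λ : Finset V) :
    Measurable (boltzmann G ρ β Λ) := by
  refine ENNReal.measurable_ofReal.comp (Finset.measurable_prod _ fun b _ => ?_)
  exact (Measurable.of_discrete (f := Q β)).comp
    ((measurable_pi_apply b.1.2).sub (measurable_pi_apply b.1.1))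

theorem gradSpec_apply (hG : G.IsTree) (ρ : V) (β : ℝ) (Λ : Finset V) (ζ : GradConf G ρ)
    {A : Set (GradConf G ρ)} (hA : MeasurableSet A) :
    gradSpec hG ρ β Λ ζ A = (partitionFn G ρ β Λ (heights hG ζ))⁻¹ *
      ∑' σ : Λ → ℤ, boltzmann G ρ β Λ (glue Λ σ (heights hG ζ)) *
        A.indicator 1 (grad G ρ (glue Λ σ (heights hG ζ))) := by
  have hA' := measurable_grad G ρ hA
  rw [gradSpec, Measure.map_apply (measurable_grad G ρ) hA, gibbsSpec, Measure.smul_apply,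
    Measure.sum_apply _ hA', smul_eq_mul]
  congr 1
  refine tsum_congr fun σ => ?_
  rw [Measure.smul_apply, Measure.dirac_apply' _ hA', smul_eq_mul]
  rfl

theorem measurable_gradSpec (hG : G.IsTree) (ρ : V) (β : ℝ) (Λ : Finset V) :
    Measurable (gradSpec hG ρ β Λ) := by
  refine Measure.measurable_of_measurable_coe _ fun A hA => ?_
  simp only [gradSpec_apply hG ρ β Λ _ hA]
  have hg : ∀ σ, Measurable fun ζ : GradConf G ρ => glue Λ σ (heights hG ζ) := fun σ =>
    (measurable_glue Λ σ).comp (measurable_heights hG ρ)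
  have hb : ∀ σ, Measurable fun ζ : GradConf G ρ =>
      boltzmann G ρ β Λ (glue Λ σ (heights hG ζ)) := fun σ =>
    (measurable_boltzmann ρ β Λ).comp (hg σ)
  refine Measurable.mul (Measurable.inv ?_) ?_
  · exact Measurable.tsum hb
  · refine Measurable.tsum fun σ => (hb σ).mul ?_
    exact (measurable_one.indicator hA).comp ((measurable_grad G ρ).comp (hg σ))

theorem boltzmann_ne_zero (ρ : V) (β : ℝ) (Λ : Finset V) (ω : V → ℤ) :
    boltzmann G ρ β Λ ω ≠ 0 := by
  rw [boltzmann, ne_eq, ENNReal.ofReal_eq_zero, not_le]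
  exact Finset.prod_pos fun _ _ => Q_pos _ _

theorem partitionFn_ne_zero (ρ : V) (β : ℝ) (Λ : Finset V) (ω : V → ℤ) :
    partitionFn G ρ β Λ ω ≠ 0 := by
  intro h
  exact boltzmann_ne_zero ρ β Λ _ (ENNReal.tsum_eq_zero.1 h 0)

theorem isProbabilityMeasure_gradSpec (hG : G.IsTree) {ρ : V} {β : ℝ} {Λ : Finset V}
    {ζ : GradConf G ρ} (h : partitionFn G ρ β Λ (heights hG ζ) ≠ ∞) :
    IsProbabilityMeasure (gradSpec hG ρ β Λ ζ) := by
  constructor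
  rw [gradSpec_apply hG ρ β Λ ζ MeasurableSet.univ]
  simp only [Set.indicator_univ, Pi.one_apply, mul_one]
  exact ENNReal.inv_mul_cancel (partitionFn_ne_zero _ _ _ _) h

/-- Two height configurations coincide up to a constant on `Λ' ∪ ∂Λ'` off `Λ`. -/
def ShiftRel (G : SimpleGraph V) [G.LocallyFinite] (Λ Λ' : Finset V) (ω ω' : V → ℤ) : Prop :=
  ∃ c : ℤ, ∀ x ∈ closureOf G Λ', x ∉ Λ → ω' x = ω x + c

theorem ShiftRel.symm {Λ Λ' : Finset V} {ω ω' : V → ℤ} (h : ShiftRel G Λ Λ' ω ω') :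
    ShiftRel G Λ Λ' ω' ω := by
  obtain ⟨c, hc⟩ := h
  exact ⟨-c, fun x hx hx' => by rw [hc x hx hx']; ring⟩

theorem ShiftRel.trans {Λ Λ' : Finset V} {ω ω' ω'' : V → ℤ} (h : ShiftRel G Λ Λ' ω ω')
    (h' : ShiftRel G Λ Λ' ω' ω'') : ShiftRel G Λ Λ' ω ω'' := by
  obtain ⟨c, hc⟩ := h
  obtain ⟨c', hc'⟩ := h'
  exact ⟨c + c', fun x hx hx' => by rw [hc' x hx hx', hc x hx hx']; ring⟩

section DLR

variable {ρ : V} {β : ℝ} {Λ Λ' : Finset V}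

theorem edgesMeeting_mono (h : Λ ⊆ Λ') : edgesMeeting G ρ Λ ⊆ edgesMeeting G ρ Λ' := by
  intro b hb
  rw [mem_edgesMeeting] at hb ⊢
  exact hb.imp (fun H => h H) (fun H => h H)

theorem boltzmann_congr (hΛ : Λ ⊆ Λ') {ω ω' : V → ℤ}
    (h : ∀ b ∈ edgesMeeting G ρ Λ', grad G ρ ω b = grad G ρ ω' b) :
    boltzmann G ρ β Λ ω = boltzmann G ρ β Λ ω' := by
  rw [boltzmann, boltzmann, Finset.prod_congr rfl fun b hb => by rw [h b (edgesMeeting_mono hΛ hb)]]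

theorem grad_congr_of_shift (hG : G.IsTree) (hΛ' : Conn G Λ') {ω ω' : V → ℤ} {c : ℤ}
    (h : ∀ x ∈ closureOf G Λ', ω' x = ω x + c) {b : OEdge G ρ} (hb : b ∈ edgesMeeting G ρ Λ') :
    grad G ρ ω' b = grad G ρ ω b := by
  obtain ⟨h1, h2⟩ := (hΛ'.mem_edgesMeeting_iff hG b).1 hb
  simp only [grad, h _ h1, h _ h2]
  ring

/-- Adding the same constant to the heights in `Λ` is a bijection of the summation index that
preserves all relevant gradients. -/
theorem ShiftRel.partitionFn_eq (hG : G.IsTree) (hΛ' : Conn G Λ') (hΛ : Λ ⊆ Λ') {ω ω' : V → ℤ}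
    (h : ShiftRel G Λ Λ' ω ω') : partitionFn G ρ β Λ ω = partitionFn G ρ β Λ ω' := by
  obtain ⟨c, hc⟩ := h
  rw [partitionFn, partitionFn, ← (Equiv.addRight (fun _ : Λ => c)).tsum_eq
    (fun σ => boltzmann G ρ β Λ (glue Λ σ ω'))]
  refine tsum_congr fun σ => (boltzmann_congr hΛ fun b hb =>
    grad_congr_of_shift hG hΛ' (c := c) (fun x hx => ?_) hb).symm
  by_cases hxΛ : x ∈ Λ
  · rw [glue_of_mem hxΛ, glue_of_mem hxΛ]; rfl
  · rw [glue_of_notMem hxΛ, glue_of_notMem hxΛ, hc x hx hxΛ]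

theorem shiftRel_of_grad_eq (hG : G.IsTree) (hΛ' : Conn G Λ') {ω ω' : V → ℤ}
    (h : ∀ b ∈ edgesMeeting G ρ Λ', grad G ρ ω b = grad G ρ ω' b) : ShiftRel G Λ Λ' ω ω' := by
  obtain ⟨w, hw⟩ := hΛ'.nonempty
  refine ⟨ω' w - ω w, fun x hx _ => ?_⟩
  have := Conn.exists_shift hG hΛ' h (subset_closureOf _ hw) hx
  omega

/-- A configuration off `Λ` and the gradients determine the heights in `Λ`. -/
theorem glue_eq_of_grad (hG : G.IsTree) (hdeg : G.IsRegularOfDegree 3) (hΛ' : Conn G Λ')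
    (hΛ : Λ ⊆ Λ') {ω ω' : V → ℤ} {c : ℤ}
    (hc : ∀ x ∈ closureOf G Λ', x ∉ Λ → ω' x = ω x + c) {σ : Λ → ℤ}
    (h : ∀ b ∈ edgesMeeting G ρ Λ', grad G ρ (glue Λ σ ω) b = grad G ρ ω' b) :
    σ = fun x : Λ => ω' x - c := by
  -- A boundary vertex of `Λ'` lies off `Λ`; its height fixes the additive constant that gradients
  -- leave open.
  obtain ⟨w, hw⟩ := Conn.outerBoundary_nonempty hG hdeg hΛ'
  obtain ⟨hw1, hw2⟩ := mem_outerBoundary.1 hw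
  have hwc : w ∈ closureOf G Λ' := mem_closureOf.2 (Or.inr hw1)
  have hwΛ : w ∉ Λ := fun H => hw2 (hΛ H)
  funext x
  have hx : x.1 ∈ closureOf G Λ' := subset_closureOf _ (hΛ x.2)
  have := Conn.exists_shift hG hΛ' h hwc hx
  rw [glue_of_mem x.2, glue_of_notMem hwΛ, hc w hwc hwΛ] at this
  simp only [Subtype.coe_eta] at this
  omega

-- At most one filling `σ` of `Λ` has the prescribed gradients, and one exists exactly when the
-- heights off `Λ` agree up to a constant. The sum in the kernel then has a single term.
open Classical in
theorem gradSpec_cyl (hG : G.IsTree) (hdeg : G.IsRegularOfDegree 3) (hΛ' : Conn G Λ')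
    (hΛ : Λ ⊆ Λ') (ζ : GradConf G ρ) (ω : V → ℤ) :
    gradSpec hG ρ β Λ ζ (cyl Λ' (grad G ρ ω)) =
      if ShiftRel G Λ Λ' (heights hG ζ) ω then
        (partitionFn G ρ β Λ (heights hG ζ))⁻¹ * boltzmann G ρ β Λ ω else 0 := by
  rw [gradSpec_apply hG ρ β Λ ζ (measurableSet_cyl _ _)]
  split_ifs with hR
  · obtain ⟨c, hc⟩ := hR
    congr 1
    have hshift : ∀ x ∈ closureOf G Λ',
        glue Λ (fun x : Λ => ω x - c) (heights hG ζ) x = ω x + -c := by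
      intro x hx
      by_cases hxΛ : x ∈ Λ
      · rw [glue_of_mem hxΛ]; ring
      · rw [glue_of_notMem hxΛ, hc x hx hxΛ]; ring
    have hgrad : ∀ b ∈ edgesMeeting G ρ Λ',
        grad G ρ (glue Λ (fun x : Λ => ω x - c) (heights hG ζ)) b = grad G ρ ω b :=
      fun b hb => grad_congr_of_shift hG hΛ' hshift hb
    rw [tsum_eq_single (fun x : Λ => ω x - c), Set.indicator_of_mem, Pi.one_apply, mul_one,
      boltzmann_congr hΛ hgrad]
    · exact hgrad
    · intro σ hσ
      rw [Set.indicator_of_notMem, mul_zero]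
      exact fun H => hσ (glue_eq_of_grad hG hdeg hΛ' hΛ hc H)
  · rw [ENNReal.tsum_eq_zero.2, mul_zero]
    intro σ
    rw [Set.indicator_of_notMem, mul_zero]
    intro H
    obtain ⟨c, hc⟩ := shiftRel_of_grad_eq (Λ := Λ) hG hΛ' H
    exact hR ⟨c, fun x hx hxΛ => by rw [hc x hx hxΛ, glue_of_notMem hxΛ]⟩

theorem gradSpec_cyl_congr (hG : G.IsTree) (hdeg : G.IsRegularOfDegree 3) (hΛ' : Conn G Λ')
    (hΛ : Λ ⊆ Λ') {ζ ζ' : GradConf G ρ} (h : restr Λ' ζ = restr Λ' ζ') (ζ₀ : GradConf G ρ) :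
    gradSpec hG ρ β Λ ζ (cyl Λ' ζ₀) = gradSpec hG ρ β Λ ζ' (cyl Λ' ζ₀) := by
  classical
  have hrel : ShiftRel G Λ Λ' (heights hG ζ) (heights hG ζ') :=
    shiftRel_of_grad_eq hG hΛ' fun b hb => by
      rw [grad_heights, grad_heights]
      exact congrFun h ⟨b, hb⟩
  rw [← grad_heights hG ζ₀, gradSpec_cyl hG hdeg hΛ' hΛ, gradSpec_cyl hG hdeg hΛ' hΛ,
    hrel.partitionFn_eq hG hΛ' hΛ]
  exact if_congr ⟨fun H => hrel.symm.trans H, fun H => hrel.trans H⟩ rfl rfl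

/-- The factor of the marginal that does not depend on the heights in `Λ`. -/
theorem Marg.exists_factor (hG : G.IsTree) (hΛ' : Conn G Λ') (hΛ : Λ ⊆ Λ')
    {q : ℕ} (hq : 0 < q) {l : ℤ → ℝ} (hpos : ∀ n, 0 < l n)
    (hper : ∀ n, l (n + q) = l n) {ν : Measure (GradConf G ρ)} (h : Marg β q l ν Λ') :
    ∃ κ : (V → ℤ) → ℝ≥0∞, (∀ ω, κ ω ≠ 0) ∧
      (∀ ω, ν (cyl Λ' (grad G ρ ω)) = κ ω * boltzmann G ρ β Λ ω) ∧
      ∀ ω ω', ShiftRel G Λ Λ' ω ω' → κ ω = κ ω' := by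
  classical
  obtain ⟨Z, hZ, H⟩ := h
  have hsum : ∀ ω : V → ℤ,
      0 < ∑ s ∈ Finset.range q, ∏ y ∈ outerBoundary G Λ', l ((s : ℤ) + ω y) := fun ω =>
    Finset.sum_pos (fun s _ => Finset.prod_pos fun _ _ => hpos _) ⟨0, by simpa using hq⟩
  have hQ : ∀ ω : V → ℤ,
      0 < ∏ b ∈ edgesMeeting G ρ Λ' \ edgesMeeting G ρ Λ, Q β (grad G ρ ω b) := fun ω =>
    Finset.prod_pos fun _ _ => Q_pos _ _
  -- The factor collects the boundary sum and the edges with no endpoint in `Λ`; the remaining edges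
  -- form the Boltzmann weight.
  refine ⟨fun ω => ENNReal.ofReal (Z *
    (∑ s ∈ Finset.range q, ∏ y ∈ outerBoundary G Λ', l ((s : ℤ) + ω y)) *
    ∏ b ∈ edgesMeeting G ρ Λ' \ edgesMeeting G ρ Λ, Q β (grad G ρ ω b)), ?_, ?_, ?_⟩
  · intro ω
    rw [ne_eq, ENNReal.ofReal_eq_zero, not_le]
    exact mul_pos (mul_pos hZ (hsum ω)) (hQ ω)
  · intro ω
    rw [H, weight, boltzmann, ← ENNReal.ofReal_mul
      (mul_pos (mul_pos hZ (hsum ω)) (hQ ω)).le, ← Finset.prod_sdiff (edgesMeeting_mono hΛ)]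
    congr 1
    ring
  · rintro ω ω' ⟨c, hc⟩
    have h1 : ∑ s ∈ Finset.range q, ∏ y ∈ outerBoundary G Λ', l ((s : ℤ) + ω' y) =
        ∑ s ∈ Finset.range q, ∏ y ∈ outerBoundary G Λ', l ((s : ℤ) + ω y) := by
      rw [← sum_prod_shift hper _ ω c]
      refine Finset.sum_congr rfl fun s _ => Finset.prod_congr rfl fun y hy => ?_
      obtain ⟨hy1, hy2⟩ := mem_outerBoundary.1 hy
      rw [hc y (mem_closureOf.2 (Or.inr hy1)) fun H => hy2 (hΛ H)]
    have h2 : ∀ b ∈ edgesMeeting G ρ Λ' \ edgesMeeting G ρ Λ, grad G ρ ω' b = grad G ρ ω b := by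
      intro b hb
      rw [Finset.mem_sdiff] at hb
      obtain ⟨hb1, hb2⟩ := (hΛ'.mem_edgesMeeting_iff hG b).1 hb.1
      have hb3 := hb.2
      rw [mem_edgesMeeting, not_or] at hb3
      simp only [grad, hc _ hb1 hb3.1, hc _ hb2 hb3.2]
      ring
    have h3 : ∏ b ∈ edgesMeeting G ρ Λ' \ edgesMeeting G ρ Λ, Q β (grad G ρ ω' b) =
        ∏ b ∈ edgesMeeting G ρ Λ' \ edgesMeeting G ρ Λ, Q β (grad G ρ ω b) :=
      Finset.prod_congr rfl fun b hb => by rw [h2 b hb]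
    simp only [h1, h3]

/-- Up to a non-zero factor, the partition function is the mass under the finite measure `ν` of a
disjoint union of cylinders, one for each filling of `Λ`. -/
theorem Marg.partitionFn_ne_top (hG : G.IsTree) (hdeg : G.IsRegularOfDegree 3) (hΛ' : Conn G Λ')
    (hΛ : Λ ⊆ Λ') {q : ℕ} (hq : 0 < q) {l : ℤ → ℝ} (hpos : ∀ n, 0 < l n)
    (hper : ∀ n, l (n + q) = l n) {ν : Measure (GradConf G ρ)} [IsFiniteMeasure ν]
    (h : Marg β q l ν Λ') (ω : V → ℤ) : partitionFn G ρ β Λ ω ≠ ∞ := by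
  obtain ⟨κ, hκ, hν, hrel⟩ := h.exists_factor hG hΛ' hΛ hq hpos hper
  have hoff : ∀ σ, ShiftRel G Λ Λ' ω (glue Λ σ ω) := fun σ =>
    ⟨0, fun x _ hx => by rw [glue_of_notMem hx, add_zero]⟩
  have hdisj : Pairwise (Function.onFun Disjoint fun σ : Λ → ℤ =>
      cyl Λ' (grad G ρ (glue Λ σ ω))) := by
    intro σ σ' hσ
    refine Set.disjoint_left.2 fun η h h' => hσ ?_
    have := glue_eq_of_grad (ρ := ρ) hG hdeg hΛ' hΛ (ω := ω) (ω' := glue Λ σ' ω) (c := 0)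
      (fun x _ hx => by rw [glue_of_notMem hx, add_zero]) (σ := σ)
      (fun b hb => (h b hb).symm.trans (h' b hb))
    rw [this]
    funext x
    rw [glue_of_mem x.2, sub_zero]
  have hle : κ ω * partitionFn G ρ β Λ ω = ν (⋃ σ : Λ → ℤ, cyl Λ' (grad G ρ (glue Λ σ ω))) := by
    rw [measure_iUnion hdisj fun σ => measurableSet_cyl _ _, partitionFn, ← ENNReal.tsum_mul_left]
    refine tsum_congr fun σ => ?_
    rw [hν, hrel _ _ (hoff σ)]
  intro htop
  rw [htop, ENNReal.mul_top (hκ ω)] at hle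
  exact measure_ne_top ν _ hle.symm

/-- For related configurations both sides are the product of the two Boltzmann weights, the common
factor and the common inverse partition function; otherwise both vanish. -/
theorem Marg.detailed_balance (hG : G.IsTree) (hdeg : G.IsRegularOfDegree 3) (hΛ' : Conn G Λ')
    (hΛ : Λ ⊆ Λ') {q : ℕ} (hq : 0 < q) {l : ℤ → ℝ} (hpos : ∀ n, 0 < l n)
    (hper : ∀ n, l (n + q) = l n) {ν : Measure (GradConf G ρ)}
    (h : Marg β q l ν Λ') (ζ ζ' : GradConf G ρ) :
    gradSpec hG ρ β Λ ζ (cyl Λ' ζ') * ν (cyl Λ' ζ) =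
      gradSpec hG ρ β Λ ζ' (cyl Λ' ζ) * ν (cyl Λ' ζ') := by
  classical
  obtain ⟨κ, -, hν, hrel⟩ := h.exists_factor hG hΛ' hΛ hq hpos hper
  have h1 := gradSpec_cyl (β := β) hG hdeg hΛ' hΛ ζ (heights hG ζ')
  have h2 := gradSpec_cyl (β := β) hG hdeg hΛ' hΛ ζ' (heights hG ζ)
  have h3 := hν (heights hG ζ)
  have h4 := hν (heights hG ζ')
  rw [grad_heights] at h1 h2 h3 h4
  rw [h1, h2, h3, h4]
  by_cases hR : ShiftRel G Λ Λ' (heights hG ζ) (heights hG ζ')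
  · rw [if_pos hR, if_pos hR.symm, hrel _ _ hR, hR.partitionFn_eq hG hΛ' hΛ]
    ring
  · rw [if_neg hR, if_neg fun H => hR H.symm, zero_mul, zero_mul]

/-- The integrand depends only on the restriction to `Λ'`, so the integral is a countable sum.
Detailed balance exchanges the two configurations, and the kernel has total mass 1. -/
theorem Marg.lintegral_gradSpec_cyl (hG : G.IsTree) (hdeg : G.IsRegularOfDegree 3)
    (hΛ' : Conn G Λ') (hΛ : Λ ⊆ Λ') {q : ℕ} (hq : 0 < q) {l : ℤ → ℝ} (hpos : ∀ n, 0 < l n)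
    (hper : ∀ n, l (n + q) = l n) {ν : Measure (GradConf G ρ)} [IsFiniteMeasure ν]
    (h : Marg β q l ν Λ') (ζ' : GradConf G ρ) :
    ∫⁻ ζ, gradSpec hG ρ β Λ ζ (cyl Λ' ζ') ∂ν = ν (cyl Λ' ζ') := by
  have := isProbabilityMeasure_gradSpec hG (β := β) (Λ := Λ) (ζ := ζ')
    (h.partitionFn_ne_top hG hdeg hΛ' hΛ hq hpos hper _)
  calc ∫⁻ ζ, gradSpec hG ρ β Λ ζ (cyl Λ' ζ') ∂ν
      = ∫⁻ ζ, (fun e => gradSpec hG ρ β Λ (extendZero Λ' e) (cyl Λ' ζ')) (restr Λ' ζ) ∂ν := by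
        refine lintegral_congr fun ζ => gradSpec_cyl_congr hG hdeg hΛ' hΛ ?_ ζ'
        rw [restr_extendZero]
    _ = ∫⁻ e, gradSpec hG ρ β Λ (extendZero Λ' e) (cyl Λ' ζ') ∂(ν.map (restr Λ')) :=
        (lintegral_map (f := fun e => gradSpec hG ρ β Λ (extendZero Λ' e) (cyl Λ' ζ'))
          Measurable.of_discrete (measurable_restr Λ')).symm
    _ = ∑' e, gradSpec hG ρ β Λ (extendZero Λ' e) (cyl Λ' ζ') * ν (cyl Λ' (extendZero Λ' e)) := by
        rw [lintegral_countable']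
        simp only [map_restr_singleton]
    _ = ∑' e, gradSpec hG ρ β Λ ζ' (cyl Λ' (extendZero Λ' e)) * ν (cyl Λ' ζ') :=
        tsum_congr fun e => h.detailed_balance hG hdeg hΛ' hΛ hq hpos hper _ _
    _ = ν (cyl Λ' ζ') := by rw [ENNReal.tsum_mul_right, tsum_cyl, one_mul]

end DLR

/-- A probability measure with the marginals of a periodic positive function is a gradient Gibbs
measure. -/
theorem isGGM_of_marg (hG : G.IsTree) (hdeg : G.IsRegularOfDegree 3) {ρ : V} {β : ℝ} {q : ℕ}
    (hq : 0 < q) {l : ℤ → ℝ} (hpos : ∀ n, 0 < l n) (hper : ∀ n, l (n + q) = l n)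
    {ν : Measure (GradConf G ρ)} [hν : IsProbabilityMeasure ν]
    (h : ∀ n, Marg β q l ν (ball G ρ n)) : IsGGM hG ρ β ν := by
  refine ⟨hν, fun Λ A hA => ?_⟩
  obtain ⟨N, hN⟩ := exists_subset_ball hG ρ Λ
  have hbind : ∀ A, MeasurableSet A →
      ν.bind (gradSpec hG ρ β Λ) A = ∫⁻ ζ, gradSpec hG ρ β Λ ζ A ∂ν := fun A hA =>
    Measure.bind_apply hA (measurable_gradSpec hG ρ β Λ).aemeasurable
  -- As an identity of measures, the DLR equation needs checking only on cylinders over balls that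
  -- contain `Λ`.
  have : ν.bind (gradSpec hG ρ β Λ) = ν := by
    refine measure_ext_of_cyl hG N fun n hn ζ => ?_
    rw [hbind _ (measurableSet_cyl _ _)]
    exact (h n).lintegral_gradSpec_cyl hG hdeg (conn_ball ρ n) (hN.trans (ball_mono ρ hn)) hq hpos
      hper ζ
  rw [← hbind A hA, this]

/-- The marginals of a periodic positive function determine a probability measure. -/
theorem Marg.unique (hG : G.IsTree) {ρ : V} {β : ℝ} {q : ℕ} {l : ℤ → ℝ}
    {μ ν : Measure (GradConf G ρ)} [IsProbabilityMeasure μ] [IsProbabilityMeasure ν]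
    (hμ : ∀ n, Marg β q l μ (ball G ρ n)) (hν : ∀ n, Marg β q l ν (ball G ρ n)) : μ = ν := by
  refine measure_ext_of_cyl hG 0 fun n _ ζ => ?_
  obtain ⟨Z, hZ, HZ⟩ := hμ n
  obtain ⟨Y, hY, HY⟩ := hν n
  -- Both marginals are proportional to the same weight; summing over all cylinders forces the ratio
  -- `r` to be 1.
  set r := ENNReal.ofReal (Z / Y)
  have hr : ∀ ζ, μ (cyl (ball G ρ n) ζ) = r * ν (cyl (ball G ρ n) ζ) := by
    intro ζ
    have h1 := HZ (heights hG ζ)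
    have h2 := HY (heights hG ζ)
    rw [grad_heights] at h1 h2
    rw [h1, h2, ← ENNReal.ofReal_mul (by positivity)]
    congr 1
    field_simp
  have h1 := tsum_cyl (ball G ρ n) μ
  simp only [hr] at h1
  rw [ENNReal.tsum_mul_left, tsum_cyl, mul_one] at h1
  rw [hr, h1, one_mul]

end Specification

/-! ### The boundary law equation as a polynomial system -/

theorem Q_natCast (β : ℝ) (n : ℕ) : Q β n = Real.exp (-β) ^ n := by
  rw [Q, ← Real.exp_nat_mul]
  congr 1
  simp
  ring

theorem summable_Q {β : ℝ} (hβ : 0 < β) : Summable (Q β) := by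
  have h : Summable fun n : ℕ => Q β n := by
    simp only [Q_natCast]
    exact summable_geometric_of_lt_one (Real.exp_pos _).le (by simpa using hβ)
  exact Summable.of_nat_of_neg h (by simpa only [Q_neg] using h)

/-- Away from 0 the two neighbours of `m` carry the factors exp(β) and exp(-β); at 0 both carry
exp(-β), which causes the defect 2 sinh β. -/
theorem Q_recurrence (β : ℝ) (m : ℤ) :
    Q β (m + 1) + Q β (m - 1) =
      2 * Real.cosh β * Q β m - if m = 0 then 2 * Real.sinh β else 0 := by
  rw [Real.cosh_eq, Real.sinh_eq]
  rcases lt_trichotomy m 0 with h | rfl | h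
  · have h1 : ((m : ℝ) + 1) ≤ 0 := by exact_mod_cast h
    have e1 : Q β (m + 1) = Q β m * Real.exp β := by
      simp only [Q, ← Real.exp_add]
      push_cast
      rw [abs_of_nonpos h1, abs_of_nonpos (by linarith : (m : ℝ) ≤ 0)]
      congr 1; ring
    have e2 : Q β (m - 1) = Q β m * Real.exp (-β) := by
      simp only [Q, ← Real.exp_add]
      push_cast
      rw [abs_of_nonpos (by linarith : (m : ℝ) - 1 ≤ 0), abs_of_nonpos (by linarith : (m : ℝ) ≤ 0)]
      congr 1; ring
    rw [e1, e2, if_neg h.ne]; ring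
  · simp [Q]; ring
  · have h1 : 1 ≤ (m : ℝ) := by exact_mod_cast h
    have e1 : Q β (m - 1) = Q β m * Real.exp β := by
      simp only [Q, ← Real.exp_add]
      push_cast
      rw [abs_of_nonneg (by linarith : 0 ≤ (m : ℝ) - 1), abs_of_nonneg (by linarith : 0 ≤ (m : ℝ))]
      congr 1; ring
    have e2 : Q β (m + 1) = Q β m * Real.exp (-β) := by
      simp only [Q, ← Real.exp_add]
      push_cast
      rw [abs_of_nonneg (by linarith : 0 ≤ (m : ℝ) + 1), abs_of_nonneg (by linarith : 0 ≤ (m : ℝ))]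
      congr 1; ring
    rw [e1, e2, if_neg h.ne']; ring

theorem conv_recurrence {β : ℝ} {l : ℤ → ℝ} (hs : ∀ i, Summable fun j => Q β (i - j) * l j)
    (i : ℤ) : conv β l (i + 1) + conv β l (i - 1) =
      2 * Real.cosh β * conv β l i - 2 * Real.sinh β * l i := by
  have h1 := (hs (i + 1)).hasSum.add (hs (i - 1)).hasSum
  have h2 := ((hs i).hasSum.mul_left (2 * Real.cosh β)).sub
    (hasSum_ite_eq i (2 * Real.sinh β * l i))
  refine h1.unique (h2.congr_fun fun j => ?_)
  have := Q_recurrence β (i - j)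
  rw [show i + 1 - j = i - j + 1 by ring, show i - 1 - j = i - j - 1 by ring, ← add_mul, this]
  by_cases h : j = i
  · subst h; simp; ring
  · rw [if_neg h, if_neg (by omega)]; ring

theorem conv_periodic {β : ℝ} {l : ℤ → ℝ} {q : ℤ} (hl : ∀ n, l (n + q) = l n) (i : ℤ) :
    conv β l (i + q) = conv β l i := by
  rw [conv, conv, ← (Equiv.addRight q).tsum_eq fun j => Q β (i + q - j) * l j]
  refine tsum_congr fun j => ?_
  simp [hl]

theorem fourPeriodic_add (a b : ℝ) (n : ℤ) : fourPeriodic a b (n + (4 : ℕ)) = fourPeriodic a b n := by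
  simp [fourPeriodic]

theorem fourPeriodic_pos {a b : ℝ} (ha : 0 < a) (hb : 0 < b) (n : ℤ) : 0 < fourPeriodic a b n := by
  unfold fourPeriodic
  split_ifs <;> positivity

theorem fourPeriodic_le (a b : ℝ) (n : ℤ) : fourPeriodic a b n ≤ 1 + a ^ 2 + b ^ 2 := by
  unfold fourPeriodic
  split_ifs <;> nlinarith [sq_nonneg a, sq_nonneg b]

theorem summable_fourPeriodic {β : ℝ} (hβ : 0 < β) {a b : ℝ} (ha : 0 < a) (hb : 0 < b) (i : ℤ) :
    Summable fun j => Q β (i - j) * fourPeriodic a b j := by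
  have h : Summable fun j => Q β (i - j) * (1 + a ^ 2 + b ^ 2) :=
    ((Equiv.subLeft i).summable_iff.2 (summable_Q hβ)).mul_right _
  refine Summable.of_nonneg_of_le (fun j => ?_) (fun j => ?_) h
  · exact (mul_pos (Q_pos _ _) (fourPeriodic_pos ha hb j)).le
  · exact mul_le_mul_of_nonneg_left (fourPeriodic_le a b j) (Q_pos _ _).le

theorem eq_emod_of_periodic {α : Type*} {f : ℤ → α} (hf : ∀ n, f (n + (4 : ℕ)) = f n) (n : ℤ) :
    f n = f (n % 4) := by
  have h : Function.Periodic f 4 := fun n => by simpa using hf n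
  have := h.int_mul (n / 4) (n % 4)
  rw [← this]
  congr 1
  have := Int.emod_add_mul_ediv n 4
  simp only [Int.cast_id]
  omega

/-- The equations for a boundary law of the form `(1, a², 1, b²)`. -/
def LawEq (τ a b : ℝ) : Prop :=
  a * (τ * (τ + a ^ 2 + b ^ 2)) = 2 * τ + (τ ^ 2 - 2) * a ^ 2 + 2 * b ^ 2 ∧
    b * (τ * (τ + a ^ 2 + b ^ 2)) = 2 * τ + (τ ^ 2 - 2) * b ^ 2 + 2 * a ^ 2

theorem two_lt_tau {β : ℝ} (hβ : 0 < β) : 2 < 2 * Real.cosh β := by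
  have := Real.one_lt_cosh.2 hβ.ne'
  linarith

theorem conv_fourPeriodic {β : ℝ} (hβ : 0 < β) {a b : ℝ} (ha : 0 < a) (hb : 0 < b) {τ : ℝ}
    (hτ : τ = 2 * Real.cosh β) :
    ∃ r : ℝ, 0 < r ∧ conv β (fourPeriodic a b) 0 = r * (τ * (τ + a ^ 2 + b ^ 2)) ∧
      conv β (fourPeriodic a b) 1 = r * (2 * τ + (τ ^ 2 - 2) * a ^ 2 + 2 * b ^ 2) ∧
      conv β (fourPeriodic a b) 2 = r * (τ * (τ + a ^ 2 + b ^ 2)) ∧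
      conv β (fourPeriodic a b) 3 = r * (2 * τ + (τ ^ 2 - 2) * b ^ 2 + 2 * a ^ 2) := by
  have hrec := fun i => conv_recurrence (summable_fourPeriodic hβ ha hb) i
  have hper := fun i => conv_periodic (β := β) (fourPeriodic_add a b) i
  rw [← hτ] at hrec
  have h2 : 2 < τ := hτ ▸ two_lt_tau hβ
  have hd : 0 < Real.sinh β := Real.sinh_pos_iff.2 hβ
  set d := 2 * Real.sinh β with hdd
  have r0 := hrec 0
  have r1 := hrec 1
  have r2 := hrec 2
  have r3 := hrec 3
  have p0 := hper 0
  have p1 := hper (-1)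
  norm_num at r0 r1 r2 r3 p0 p1
  rw [show fourPeriodic a b 0 = 1 by simp [fourPeriodic]] at r0
  rw [show fourPeriodic a b 1 = a ^ 2 by simp [fourPeriodic]] at r1
  rw [show fourPeriodic a b 2 = 1 by simp [fourPeriodic]] at r2
  rw [show fourPeriodic a b 3 = b ^ 2 by simp [fourPeriodic]] at r3
  rw [← p1] at r0
  rw [p0] at r3
  generalize conv β (fourPeriodic a b) 0 = S0 at *
  generalize conv β (fourPeriodic a b) 1 = S1 at *
  generalize conv β (fourPeriodic a b) 2 = S2 at *
  generalize conv β (fourPeriodic a b) 3 = S3 at *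
  have h4 : 0 < τ ^ 2 - 4 := by nlinarith
  -- The recurrences at 0 and 2 have the same left side and the same source term, as the law equals
  -- 1 at both places.
  have e2 : S2 = S0 := by
    have : τ * S2 = τ * S0 := by linarith
    exact mul_left_cancel₀ (by linarith) this
  subst e2
  have e0 : (τ ^ 2 - 4) * S2 = d * (τ + a ^ 2 + b ^ 2) := by linear_combination (-1) * r1 - r3 - τ * r0
  have e1 : τ * S1 = 2 * S2 + d * a ^ 2 := by linarith
  have e3 : τ * S3 = 2 * S2 + d * b ^ 2 := by linarith
  refine ⟨d / (τ * (τ ^ 2 - 4)), by positivity, ?_, ?_, ?_, ?_⟩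
  · field_simp; linarith
  · field_simp; linear_combination (τ ^ 2 - 4) * e1 + 2 * e0
  · field_simp; linarith
  · field_simp; linear_combination (τ ^ 2 - 4) * e3 + 2 * e0

/-- The equation at the even sites determines `c`. With `c` eliminated, the equations at 1 and 3 are
equalities of squares of positive numbers, so a and b are ratios of convolutions. -/
theorem isBoundaryLaw_fourPeriodic_iff {β : ℝ} (hβ : 0 < β) {a b : ℝ} (ha : 0 < a) (hb : 0 < b)
    {τ : ℝ} (hτ : τ = 2 * Real.cosh β) :
    IsBoundaryLaw β 2 (fourPeriodic a b) ↔ LawEq τ a b := by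
  obtain ⟨r, hr, h0, h1, h2, h3⟩ := conv_fourPeriodic hβ ha hb hτ
  have hτ2 : 2 < τ := hτ ▸ two_lt_tau hβ
  have h4 : 0 < τ ^ 2 - 2 := by nlinarith
  have hS0 : 0 < τ * (τ + a ^ 2 + b ^ 2) := by positivity
  have hS1 : 0 < 2 * τ + (τ ^ 2 - 2) * a ^ 2 + 2 * b ^ 2 := by positivity
  have hS3 : 0 < 2 * τ + (τ ^ 2 - 2) * b ^ 2 + 2 * a ^ 2 := by positivity
  have z0 : fourPeriodic a b 0 = 1 := by simp [fourPeriodic]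
  have z1 : fourPeriodic a b 1 = a ^ 2 := by simp [fourPeriodic]
  have z2 : fourPeriodic a b 2 = 1 := by simp [fourPeriodic]
  have z3 : fourPeriodic a b 3 = b ^ 2 := by simp [fourPeriodic]
  constructor
  · rintro ⟨-, -, c, hc, H⟩
    have H' : ∀ i, fourPeriodic a b i = c * conv β (fourPeriodic a b) i ^ 2 := H
    have k0 := H' 0
    have k1 := H' 1
    have k3 := H' 3
    rw [z0, h0] at k0
    rw [z1, h1] at k1
    rw [z3, h3] at k3
    have key : ∀ x y : ℝ, 0 < x → 0 < y → x ^ 2 = c * (r * y) ^ 2 →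
        x * (τ * (τ + a ^ 2 + b ^ 2)) = y := by
      intro x y hx hy h
      refine (pow_left_inj₀ (by positivity) hy.le (two_ne_zero)).1 ?_
      have hcr : c * r ^ 2 * (τ * (τ + a ^ 2 + b ^ 2)) ^ 2 = 1 := by linarith
      calc (x * (τ * (τ + a ^ 2 + b ^ 2))) ^ 2
          = (c * r ^ 2 * (τ * (τ + a ^ 2 + b ^ 2)) ^ 2) * y ^ 2 := by rw [mul_pow, h]; ring
        _ = y ^ 2 := by rw [hcr, one_mul]
    exact ⟨key a _ ha hS1 k1, key b _ hb hS3 k3⟩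
  · rintro ⟨e1, e3⟩
    refine ⟨fourPeriodic_pos ha hb, summable_fourPeriodic hβ ha hb,
      ((r * (τ * (τ + a ^ 2 + b ^ 2))) ^ 2)⁻¹, by positivity, fun i => ?_⟩
    change fourPeriodic a b i = _ * conv β (fourPeriodic a b) i ^ 2
    rw [eq_emod_of_periodic (fourPeriodic_add a b) i,
      eq_emod_of_periodic (conv_periodic (fourPeriodic_add a b)) i]
    have hi : i % 4 = 0 ∨ i % 4 = 1 ∨ i % 4 = 2 ∨ i % 4 = 3 := by omega
    rcases hi with hi | hi | hi | hi <;> rw [hi]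
    · rw [z0, h0]; field_simp
    · rw [z1, h1, ← e1]; field_simp
    · rw [z2, h2]; field_simp
    · rw [z3, h3, ← e3]; field_simp

/-! ### Solutions of the polynomial system and rigidity -/

section Algebra

variable {τ a b : ℝ}

theorem lawEq_diag (hτ : 2 < τ) : LawEq τ a a ↔ a = 1 ∨ 2 * a ^ 2 - (τ - 2) * a + 2 = 0 := by
  have key : a * (τ * (τ + a ^ 2 + a ^ 2)) - (2 * τ + (τ ^ 2 - 2) * a ^ 2 + 2 * a ^ 2) =
      τ * ((a - 1) * (2 * a ^ 2 - (τ - 2) * a + 2)) := by ring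
  constructor
  · rintro ⟨h, -⟩
    have h0 : τ * ((a - 1) * (2 * a ^ 2 - (τ - 2) * a + 2)) = 0 := by rw [← key, h, sub_self]
    rcases mul_eq_zero.1 h0 with h1 | h1
    · linarith
    · rcases mul_eq_zero.1 h1 with h2 | h2
      · exact Or.inl (by linarith)
      · exact Or.inr h2
  · intro h
    have h0 : (a - 1) * (2 * a ^ 2 - (τ - 2) * a + 2) = 0 := by
      rcases h with rfl | h
      · ring
      · rw [h, mul_zero]
    rw [h0, mul_zero] at key
    exact ⟨by linarith, by linarith⟩

/-- The difference of the two equations is divisible by a - b. Their sum, combined with the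
quotient, becomes a quadratic in a + b alone after division by τ² - 4. -/
theorem lawEq_offDiag (hτ : 2 < τ) (hab : a ≠ b) :
    LawEq τ a b ↔ (a + b) ^ 2 - τ * (a + b) + τ = 0 ∧ τ * (a * b) = 2 * (a + b) := by
  have h4 : τ ^ 2 - 4 ≠ 0 := by nlinarith
  constructor
  · rintro ⟨h1, h2⟩
    have h3 : τ * (τ + a ^ 2 + b ^ 2) = (τ ^ 2 - 4) * (a + b) := by
      refine mul_left_cancel₀ (sub_ne_zero.2 hab) ?_
      linear_combination h1 - h2
    have h5 : (a + b) ^ 2 - τ * (a + b) + τ = 0 := by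
      refine mul_left_cancel₀ h4 ?_
      linear_combination h1 + h2 - (a + b - τ) * h3
    refine ⟨h5, mul_left_cancel₀ (two_ne_zero) ?_⟩
    linear_combination τ * h5 - h3
  · rintro ⟨h1, h2⟩
    have h3 : τ * (τ + a ^ 2 + b ^ 2) = (τ ^ 2 - 4) * (a + b) := by
      linear_combination τ * h1 - 2 * h2
    refine ⟨?_, ?_⟩
    · rw [h3]
      linear_combination -2 * h1 + τ * h2
    · rw [h3]
      linear_combination -2 * h1 + τ * h2

/-- A sum `s` that solves the quadratic equation is realised by a solution with `a ≠ b`. -/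
theorem exists_lawEq_of_sum (hτ : 2 < τ) {s : ℝ} (hs : s ^ 2 - τ * s + τ = 0) (h8 : 8 < τ * s) :
    ∃ a b : ℝ, 0 < a ∧ 0 < b ∧ a ≠ b ∧ a + b = s ∧ LawEq τ a b := by
  have hs0 : 0 < s := by nlinarith
  have hτ0 : 0 < τ := by linarith
  have hp : 0 < 2 * s / τ := by positivity
  have hD : 0 < s ^ 2 - 4 * (2 * s / τ) := by
    have : s ^ 2 - 4 * (2 * s / τ) = s * (τ * s - 8) / τ := by field_simp; ring
    rw [this]
    exact div_pos (mul_pos hs0 (by linarith)) hτ0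
  -- The discriminant of X² - sX + 2s/τ, whose roots have sum s and product 2s/τ.
  set r := √(s ^ 2 - 4 * (2 * s / τ)) with hr
  have hr0 : 0 < r := Real.sqrt_pos.2 hD
  have hr2 : r ^ 2 = s ^ 2 - 4 * (2 * s / τ) := Real.sq_sqrt hD.le
  have hrs : r < s := by nlinarith
  have hne : (s + r) / 2 ≠ (s - r) / 2 := by intro h; linarith
  have hsum : (s + r) / 2 + (s - r) / 2 = s := by ring
  have hprod : (s + r) / 2 * ((s - r) / 2) = 2 * s / τ := by linear_combination -hr2 / 4
  refine ⟨(s + r) / 2, (s - r) / 2, by linarith, by linarith, hne, hsum, ?_⟩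
  rw [lawEq_offDiag hτ hne, hsum, hprod]
  exact ⟨hs, by field_simp⟩

theorem LawEq.lt_of_ne (hτ : 2 < τ) (ha : 0 < a) (hb : 0 < b) (hab : a ≠ b) (h : LawEq τ a b) :
    8 < τ * (a + b) := by
  obtain ⟨-, h2⟩ := (lawEq_offDiag hτ hab).1 h
  have h3 : 0 < (a - b) ^ 2 := by
    have := sub_ne_zero.2 hab
    positivity
  have h4 : 0 < (a + b) * (τ * (a + b) - 8) := by
    have : (a + b) * (τ * (a + b) - 8) = τ * (a - b) ^ 2 := by linear_combination 4 * h2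
    rw [this]; positivity
  have := (mul_pos_iff_of_pos_left (by positivity : 0 < a + b)).1 h4
  linarith

/-- The larger solution of `s² - τ s + τ = 0`. -/
def upperSum (τ : ℝ) : ℝ := (τ + √(τ ^ 2 - 4 * τ)) / 2

theorem upperSum_spec (hτ : 4 < τ) :
    upperSum τ ^ 2 - τ * upperSum τ + τ = 0 ∧ τ / 2 < upperSum τ := by
  have h0 : 0 < τ ^ 2 - 4 * τ := by nlinarith
  have h1 := Real.sq_sqrt h0.le
  have h2 := Real.sqrt_pos.2 h0
  unfold upperSum
  exact ⟨by linear_combination h1 / 4, by linarith⟩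

theorem eq_upperSum_or (hτ : 4 < τ) {s : ℝ} (hs : s ^ 2 - τ * s + τ = 0) :
    s = upperSum τ ∨ s = τ - upperSum τ := by
  have h : (s - upperSum τ) * (s - (τ - upperSum τ)) = 0 := by
    linear_combination hs - (upperSum_spec hτ).1
  rcases mul_eq_zero.1 h with h | h
  · exact Or.inl (by linarith)
  · exact Or.inr (by linarith)

theorem lt_mul_upperSum (hτ : 4 < τ) : 8 < τ * upperSum τ := by
  have := (upperSum_spec hτ).2
  nlinarith

theorem lowerSum_spec (hτ : 4 < τ) :
    (τ - upperSum τ) ^ 2 - τ * (τ - upperSum τ) + τ = 0 := by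
  linear_combination (upperSum_spec hτ).1

/-- The product of τs - 8 over both roots s is symmetric in them and equals (τ - 4)(τ² - 4τ - 16).
The factor of the larger root is positive, and 2 + 2√5 is the positive zero of τ² - 4τ - 16. -/
theorem lt_mul_lowerSum_iff (hτ : 4 < τ) : 8 < τ * (τ - upperSum τ) ↔ 2 + 2 * √5 < τ := by
  obtain ⟨h1, h2⟩ := upperSum_spec hτ
  have h3 : (τ * (τ - upperSum τ) - 8) * (τ * upperSum τ - 8) =
      (τ - 4) * (τ ^ 2 - 4 * τ - 16) := by linear_combination -τ ^ 2 * h1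
  have h4 : 0 < τ * upperSum τ - 8 := by linarith [lt_mul_upperSum hτ]
  have h5 : 8 < τ * (τ - upperSum τ) ↔ 0 < τ ^ 2 - 4 * τ - 16 := by
    rw [← sub_pos, ← mul_pos_iff_of_pos_right h4, h3, mul_pos_iff_of_pos_left (by linarith)]
  rw [h5]
  have h6 : √5 ^ 2 = 5 := Real.sq_sqrt (by norm_num)
  have h7 : 0 ≤ √5 := Real.sqrt_nonneg 5
  constructor
  · intro h; nlinarith
  · intro h; nlinarith

theorem exists_diag_solution (hτ : 6 < τ) :
    ∃ x : ℝ, 1 < x ∧ 2 * x ^ 2 - (τ - 2) * x + 2 = 0 := by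
  have h0 : 0 < (τ - 2) ^ 2 - 16 := by nlinarith
  have h1 := Real.sq_sqrt h0.le
  have h2 := Real.sqrt_nonneg ((τ - 2) ^ 2 - 16)
  exact ⟨(τ - 2 + √((τ - 2) ^ 2 - 16)) / 4, by linarith, by linear_combination h1 / 8⟩

/-- The equation reads 2(a - 1)² = (τ - 6)a. -/
theorem eq_one_of_diag (hτ : τ ≤ 6) (ha : 0 < a) (h : 2 * a ^ 2 - (τ - 2) * a + 2 = 0) : a = 1 := by
  have : (a - 1) ^ 2 ≤ 0 := by nlinarith
  have := (pow_eq_zero_iff two_ne_zero).1 (le_antisymm this (sq_nonneg _))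
  linarith

theorem swap_of_sum_mul {a b a' b' : ℝ} (hs : a + b = a' + b') (hp : a * b = a' * b') :
    (a = a' ∧ b = b') ∨ (a = b' ∧ b = a') := by
  have h : (a - a') * (a - b') = 0 := by linear_combination a * hs - hp
  rcases mul_eq_zero.1 h with h | h
  · exact Or.inl ⟨by linarith, by linarith⟩
  · exact Or.inr ⟨by linarith, by linarith⟩

/-- The marginals of a boundary law `(1, A, 1, B)` at a star determine `{A, B}`, up to inversion if
`A = B`. -/
theorem star_rigidity {A B A' B' c : ℝ} (hA : 0 < A) (hB : 0 < B) (hA' : 0 < A') (hB' : 0 < B')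
    (hc : 0 < c) (h000 : 2 + A ^ 3 + B ^ 3 = c * (2 + A' ^ 3 + B' ^ 3))
    (h001 : A + A ^ 2 + B + B ^ 2 = c * (A' + A' ^ 2 + B' + B' ^ 2))
    (h002 : 2 + A ^ 2 * B + A * B ^ 2 = c * (2 + A' ^ 2 * B' + A' * B' ^ 2))
    (h012 : A + B + 2 * (A * B) = c * (A' + B' + 2 * (A' * B'))) :
    (A = B ∧ A' = B' ∧ (A = A' ∨ A * A' = 1)) ∨ (A = A' ∧ B = B') ∨ (A = B' ∧ B = A') := by
  -- These two differences isolate (A - B)² and (A + B)(A - B)²; for A ≠ B their quotient yields A +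
  -- B.
  have h1 : (A - B) ^ 2 = c * (A' - B') ^ 2 := by linear_combination h001 - h012
  have h2 : (A + B) * (A - B) ^ 2 = c * ((A' + B') * (A' - B') ^ 2) := by
    linear_combination h000 - h002
  by_cases hAB : A = B
  · left
    have h3 : A' = B' := by
      rw [hAB, sub_self] at h1
      have : (A' - B') ^ 2 = 0 := by
        rcases mul_eq_zero.1 (h1.symm.trans (by norm_num)) with h | h
        · linarith
        · exact h
      have := pow_eq_zero_iff (two_ne_zero) |>.1 this
      linarith
    refine ⟨hAB, h3, ?_⟩
    subst hAB h3
    -- For A = B the ratio of the first two sums is A + 1/A - 1, which determines A up to inversion.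
    have h4 : (1 + A) * (1 + A') * ((A - A') * (A * A' - 1)) = 0 := by
      linear_combination (A' + A' ^ 2) * h000 / 2 - (1 + A' ^ 3) * h001 / 2
    have h5 : (A - A') * (A * A' - 1) = 0 :=
      (mul_eq_zero.1 h4).resolve_left (by positivity)
    rcases mul_eq_zero.1 h5 with h | h
    · exact Or.inl (by linarith)
    · exact Or.inr (by linarith)
  · right
    have h3 : 0 < (A - B) ^ 2 := by
      have := sub_ne_zero.2 hAB
      positivity
    have hS : A + B = A' + B' := by
      refine mul_right_cancel₀ h3.ne' ?_
      rw [h2, h1]; ring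
    have h4 : c = 1 := by
      have h5 : 0 < 2 * (A + B) + (A + B) ^ 2 := by positivity
      refine mul_right_cancel₀ h5.ne' ?_
      have h6 : 2 * (A + B) + (A + B) ^ 2 = c * (2 * (A' + B') + (A' + B') ^ 2) := by
        linear_combination h001 + h012
      rw [← hS] at h6
      linarith
    rw [h4, ← hS, one_mul] at h012
    exact swap_of_sum_mul hS (by linarith)

end Algebra

/-! ### Equivalent laws and the count -/

section Counting

variable {V : Type*} {G : SimpleGraph V} [G.LocallyFinite]

/-- The shift is invisible to a sum over a full period, and the constant enters as a power fixed by
the size of the boundary, which the normalisation absorbs. -/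
theorem Marg.of_shift {ρ : V} {β : ℝ} {q : ℕ} {l l' : ℤ → ℝ} (hper : ∀ n, l (n + q) = l n)
    {κ : ℝ} (hκ : 0 < κ) {t : ℤ} (hl : ∀ n, l' n = κ * l (n + t)) {ν : Measure (GradConf G ρ)}
    {Λ : Finset V} (h : Marg β q l ν Λ) : Marg β q l' ν Λ := by
  obtain ⟨Z, hZ, H⟩ := h
  refine ⟨Z / κ ^ (outerBoundary G Λ).card, by positivity, fun ω => ?_⟩
  have hw : weight G ρ β q l' Λ ω = κ ^ (outerBoundary G Λ).card * weight G ρ β q l Λ ω := by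
    rw [weight, weight, ← mul_assoc, ← sum_prod_shift hper _ ω t, Finset.mul_sum]
    congr 1
    refine Finset.sum_congr rfl fun s _ => ?_
    rw [← Finset.prod_const, ← Finset.prod_mul_distrib]
    refine Finset.prod_congr rfl fun y _ => ?_
    rw [hl, add_assoc]
  rw [H, hw]
  congr 1
  field_simp

/-- `ν` is the gradient Gibbs measure assigned to the boundary law `(1, a², 1, b²)`. -/
def Assigned (hG : G.IsTree) (ρ : V) (β a b : ℝ) (ν : Measure (GradConf G ρ)) : Prop :=
  IsGGM hG ρ β ν ∧ HasMarginals hG ρ β 4 (fourPeriodic a b) ν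

section Assigned

variable {hG : G.IsTree} {ρ : V} {β a b a' b' : ℝ} {ν ν' : Measure (GradConf G ρ)}

theorem Assigned.marg (h : Assigned hG ρ β a b ν) {Λ : Finset V} (hΛ : Conn G Λ) :
    Marg β 4 (fourPeriodic a b) ν Λ :=
  (hasMarginals_iff hG (fourPeriodic_add a b) ν).1 h.2 Λ hΛ

theorem exists_assigned (hG : G.IsTree) (hdeg : G.IsRegularOfDegree 3) (ρ : V)
    (hl : IsBoundaryLaw β 2 (fourPeriodic a b)) : ∃ ν, Assigned hG ρ β a b ν := by
  have hroot := fun Λ (hΛ : Conn G Λ) hρ => Conn.marg_boundaryLawMeasure hG hdeg (ρ := ρ) hΛ hρ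
    four_pos (fourPeriodic_add a b) hl
  have := isProbabilityMeasure_boundaryLawMeasure hG ρ four_pos hl
  exact ⟨boundaryLawMeasure hG ρ 4 hl,
    isGGM_of_marg hG hdeg four_pos hl.1 (fourPeriodic_add a b)
      fun n => hroot _ (conn_ball ρ n) (root_mem_ball ρ n),
    hasMarginals_of_root hG hdeg (fourPeriodic_add a b) hl hroot⟩

theorem Assigned.unique (h : Assigned hG ρ β a b ν) (h' : Assigned hG ρ β a b ν') : ν = ν' := by
  have := h.1.1
  have := h'.1.1
  exact Marg.unique hG (fun n => h.marg (conn_ball ρ n)) fun n => h'.marg (conn_ball ρ n)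

theorem Assigned.of_shift (h : Assigned hG ρ β a b ν) {κ : ℝ} (hκ : 0 < κ) {t : ℤ}
    (hl : ∀ n, fourPeriodic a' b' n = κ * fourPeriodic a b (n + t)) :
    Assigned hG ρ β a' b' ν :=
  ⟨h.1, (hasMarginals_iff hG (fourPeriodic_add a' b') ν).2 fun _ hΛ =>
    (h.marg hΛ).of_shift (fourPeriodic_add a b) hκ hl⟩

theorem Assigned.swap (h : Assigned hG ρ β a b ν) : Assigned hG ρ β b a ν := by
  refine h.of_shift one_pos (t := 2) fun n => ?_
  rw [one_mul]
  unfold fourPeriodic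
  split_ifs <;> first | rfl | omega

theorem Assigned.inv (ha : 0 < a) (h : Assigned hG ρ β a a ν) (haa : a * a' = 1) :
    Assigned hG ρ β a' a' ν := by
  have ha' : a' = a⁻¹ := eq_inv_of_mul_eq_one_right haa
  subst ha'
  refine h.of_shift (κ := (a ^ 2)⁻¹) (by positivity) (t := 1) fun n => ?_
  unfold fourPeriodic
  split_ifs <;> first | omega | (field_simp)

/-- The sums over a period of products of three values of the boundary law are determined by the
measure, up to a factor. -/
theorem Assigned.exists_star (hdeg : G.IsRegularOfDegree 3) (ha : 0 < a) (hb : 0 < b)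
    (ha' : 0 < a') (hb' : 0 < b') (h : Assigned hG ρ β a b ν) (h' : Assigned hG ρ β a' b' ν) :
    ∃ c : ℝ, 0 < c ∧ ∀ i j k : ℤ,
      ∑ s ∈ Finset.range 4, fourPeriodic a b (s + i) *
        (fourPeriodic a b (s + j) * fourPeriodic a b (s + k)) =
      c * ∑ s ∈ Finset.range 4, fourPeriodic a' b' (s + i) *
        (fourPeriodic a' b' (s + j) * fourPeriodic a' b' (s + k)) := by
  classical
  obtain ⟨Z, hZ, H⟩ := h.marg (conn_singleton ρ)
  obtain ⟨Y, hY, H'⟩ := h'.marg (conn_singleton ρ)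
  have hcard : (outerBoundary G {ρ}).card = 3 := by
    rw [outerBoundary_singleton, SimpleGraph.card_neighborFinset_eq_degree, hdeg ρ]
  obtain ⟨x, y, z, hxy, hxz, hyz, hN⟩ := Finset.card_eq_three.1 hcard
  refine ⟨Y / Z, by positivity, fun i j k => ?_⟩
  -- Heights i, j, k at the three neighbours of the root; the factors `Q` are common to both laws
  -- and cancel.
  let ω : V → ℤ := fun v => if v = x then i else if v = y then j else k
  have hx : ω x = i := by simp [ω]
  have hy : ω y = j := by simp [ω, hxy.symm]
  have hz : ω z = k := by simp [ω, hxz.symm, hyz.symm]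
  have hQ : 0 < ∏ e ∈ edgesMeeting G ρ {ρ}, Q β (grad G ρ ω e) :=
    Finset.prod_pos fun _ _ => Q_pos _ _
  have hw : ∀ a b : ℝ, weight G ρ β 4 (fourPeriodic a b) {ρ} ω =
      (∑ s ∈ Finset.range 4, fourPeriodic a b (s + i) *
        (fourPeriodic a b (s + j) * fourPeriodic a b (s + k))) *
        ∏ e ∈ edgesMeeting G ρ {ρ}, Q β (grad G ρ ω e) := by
    intro a b
    rw [weight, hN]
    congr 1
    refine Finset.sum_congr rfl fun s _ => ?_
    rw [Finset.prod_insert (by simp [hxy, hxz]), Finset.prod_insert (by simp [hyz]),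
      Finset.prod_singleton, hx, hy, hz]
  have hpos : ∀ a b : ℝ, 0 < a → 0 < b → 0 ≤ ∑ s ∈ Finset.range 4, fourPeriodic a b (s + i) *
        (fourPeriodic a b (s + j) * fourPeriodic a b (s + k)) := fun a b ha hb =>
    Finset.sum_nonneg fun s _ => (mul_pos (fourPeriodic_pos ha hb _)
      (mul_pos (fourPeriodic_pos ha hb _) (fourPeriodic_pos ha hb _))).le
  have heq := (H ω).symm.trans (H' ω)
  rw [hw, hw, ENNReal.ofReal_eq_ofReal_iff
    (mul_nonneg hZ.le (mul_nonneg (hpos a b ha hb) hQ.le))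
    (mul_nonneg hY.le (mul_nonneg (hpos a' b' ha' hb') hQ.le)), ← mul_assoc, ← mul_assoc] at heq
  have := mul_right_cancel₀ hQ.ne' heq
  rw [div_mul_eq_mul_div, eq_div_iff hZ.ne', ← this, mul_comm]

theorem Assigned.rigidity (hdeg : G.IsRegularOfDegree 3) (ha : 0 < a) (hb : 0 < b)
    (ha' : 0 < a') (hb' : 0 < b') (h : Assigned hG ρ β a b ν) (h' : Assigned hG ρ β a' b' ν) :
    (a = b ∧ a' = b' ∧ (a = a' ∨ a * a' = 1)) ∨ (a = a' ∧ b = b') ∨ (a = b' ∧ b = a') := by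
  obtain ⟨c, hc, H⟩ := h.exists_star hdeg ha hb ha' hb' h'
  have h000 := H 0 0 0
  have h001 := H 0 0 1
  have h002 := H 0 0 2
  have h012 := H 0 1 2
  simp [Finset.sum_range_succ, fourPeriodic] at h000 h001 h002 h012
  have hinj : ∀ {x y : ℝ}, 0 < x → 0 < y → x ^ 2 = y ^ 2 → x = y := fun hx hy h =>
    (pow_left_inj₀ hx.le hy.le two_ne_zero).1 h
  have hone : a ^ 2 * a' ^ 2 = 1 → a * a' = 1 := fun h =>
    hinj (mul_pos ha ha') one_pos (by rw [mul_pow, h, one_pow])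
  have key := star_rigidity (A := a ^ 2) (B := b ^ 2) (A' := a' ^ 2) (B' := b' ^ 2) (c := c)
    (by positivity) (by positivity) (by positivity) (by positivity) hc
    (by linear_combination h000) (by linear_combination h001) (by linear_combination h002)
    (by linear_combination h012)
  rcases key with ⟨h1, h2, h3⟩ | ⟨h1, h2⟩ | ⟨h1, h2⟩
  · exact Or.inl ⟨hinj ha hb h1, hinj ha' hb' h2, h3.imp (hinj ha ha') hone⟩
  · exact Or.inr (Or.inl ⟨hinj ha ha' h1, hinj hb hb' h2⟩)
  · exact Or.inr (Or.inr ⟨hinj ha hb' h1, hinj hb ha' h2⟩)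

theorem mem_fourPeriodicGGMs_iff (hβ : 0 < β) {τ : ℝ} (hτ : τ = 2 * Real.cosh β) :
    ν ∈ fourPeriodicGGMs hG ρ β ↔
      ∃ a b : ℝ, 0 < a ∧ 0 < b ∧ LawEq τ a b ∧ Assigned hG ρ β a b ν := by
  constructor
  · rintro ⟨h, a, b, ha, hb, hl, hm⟩
    exact ⟨a, b, ha, hb, (isBoundaryLaw_fourPeriodic_iff hβ ha hb hτ).1 hl, h, hm⟩
  · rintro ⟨a, b, ha, hb, hl, h, hm⟩
    exact ⟨h, a, b, ha, hb, (isBoundaryLaw_fourPeriodic_iff hβ ha hb hτ).2 hl, hm⟩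

theorem LawEq.exists_mem (hG : G.IsTree) (hdeg : G.IsRegularOfDegree 3) (ρ : V) (hβ : 0 < β)
    {τ : ℝ} (hτ : τ = 2 * Real.cosh β) (ha : 0 < a) (hb : 0 < b) (h : LawEq τ a b) :
    ∃ ν ∈ fourPeriodicGGMs hG ρ β, Assigned hG ρ β a b ν := by
  obtain ⟨ν, hν⟩ := exists_assigned hG hdeg ρ ((isBoundaryLaw_fourPeriodic_iff hβ ha hb hτ).2 h)
  exact ⟨ν, (mem_fourPeriodicGGMs_iff hβ hτ).2 ⟨a, b, ha, hb, h, hν⟩, hν⟩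

/-- Solutions with `a ≠ b` and the same sum `a + b` give the same measure. -/
theorem Assigned.eq_of_sum {τ : ℝ} (hτ : 2 < τ) (hab : a ≠ b) (hab' : a' ≠ b')
    (hl : LawEq τ a b) (hl' : LawEq τ a' b') (hs : a + b = a' + b')
    (h : Assigned hG ρ β a b ν) (h' : Assigned hG ρ β a' b' ν') : ν = ν' := by
  have h1 := ((lawEq_offDiag hτ hab).1 hl).2
  have h2 := ((lawEq_offDiag hτ hab').1 hl').2
  have hp : a * b = a' * b' := by
    refine mul_left_cancel₀ (by linarith : τ ≠ 0) ?_
    rw [h1, h2, hs]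
  rcases swap_of_sum_mul hs hp with ⟨rfl, rfl⟩ | ⟨rfl, rfl⟩
  · exact h.unique h'
  · exact h.swap.unique h'

/-- Solutions `a = b ≠ 1` give the same measure. -/
theorem Assigned.eq_of_diag {τ : ℝ} (ha : 0 < a)
    (hl : 2 * a ^ 2 - (τ - 2) * a + 2 = 0) (hl' : 2 * a' ^ 2 - (τ - 2) * a' + 2 = 0)
    (h : Assigned hG ρ β a a ν) (h' : Assigned hG ρ β a' a' ν') : ν = ν' := by
  have key : (a - a') * (a * a' - 1) = 0 := by linear_combination (a' * hl - a * hl') / 2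
  rcases mul_eq_zero.1 key with h1 | h1
  · obtain rfl : a = a' := by linarith
    exact h.unique h'
  · exact (h.inv ha (by linarith)).unique h'

theorem Assigned.ne_of_sum_ne (hdeg : G.IsRegularOfDegree 3) (ha : 0 < a) (hb : 0 < b)
    (ha' : 0 < a') (hb' : 0 < b') (hab : a ≠ b) (hs : a + b ≠ a' + b')
    (h : Assigned hG ρ β a b ν) (h' : Assigned hG ρ β a' b' ν') : ν ≠ ν' := by
  rintro rfl
  rcases h.rigidity hdeg ha hb ha' hb' h' with ⟨h1, -⟩ | ⟨rfl, rfl⟩ | ⟨rfl, rfl⟩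
  · exact hab h1
  · exact hs rfl
  · exact hs (add_comm _ _)

theorem Assigned.ne_of_ne_of_eq (hdeg : G.IsRegularOfDegree 3) (ha : 0 < a) (ha' : 0 < a')
    (hb' : 0 < b') (hab : a' ≠ b') (h : Assigned hG ρ β a a ν) (h' : Assigned hG ρ β a' b' ν') :
    ν ≠ ν' := by
  rintro rfl
  rcases h.rigidity hdeg ha ha ha' hb' h' with ⟨-, h1, -⟩ | ⟨rfl, rfl⟩ | ⟨rfl, rfl⟩ <;>
    exact hab (by first | rfl | assumption)

theorem Assigned.ne_of_one_lt (hdeg : G.IsRegularOfDegree 3) (ha : 1 < a)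
    (h : Assigned hG ρ β 1 1 ν) (h' : Assigned hG ρ β a a ν') : ν ≠ ν' := by
  rintro rfl
  rcases h.rigidity hdeg one_pos one_pos (by linarith) (by linarith) h' with
    ⟨-, -, h1 | h1⟩ | ⟨h1, -⟩ | ⟨h1, -⟩ <;> linarith

end Assigned

/-- The number of gradient Gibbs measures assigned to boundary laws `(1, a², 1, b²)`. -/
theorem encard_fourPeriodicGGMs (G : SimpleGraph V) [G.LocallyFinite] (hG : G.IsTree)
    (hdeg : G.IsRegularOfDegree 3) (ρ : V) (β : ℝ) (hβ : 0 < β) (τ : ℝ)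
    (hτ : τ = 2 * Real.cosh β) :
    (τ ≤ 4 → (fourPeriodicGGMs hG ρ β).encard = 1) ∧
    (4 < τ → τ ≤ 6 → (fourPeriodicGGMs hG ρ β).encard = 2) ∧
    (6 < τ → τ ≤ 2 + 2 * √5 → (fourPeriodicGGMs hG ρ β).encard = 3) ∧
    (2 + 2 * √5 < τ → (fourPeriodicGGMs hG ρ β).encard = 4) := by
  have h2 : 2 < τ := hτ ▸ two_lt_tau hβ
  have hmem := fun ν => mem_fourPeriodicGGMs_iff (hG := hG) (ρ := ρ) (ν := ν) hβ hτ
  have h11 : LawEq τ 1 1 := (lawEq_diag h2).2 (Or.inl rfl)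
  obtain ⟨ν₁, m₁, H₁⟩ := h11.exists_mem hG hdeg ρ hβ hτ one_pos one_pos
  have h5 : 6 < 2 + 2 * √5 := by
    have : 2 < √5 := Real.lt_sqrt_of_sq_lt (by norm_num)
    linarith
  have hupper : 4 < τ → ∃ a b ν, 0 < a ∧ 0 < b ∧ a ≠ b ∧ a + b = upperSum τ ∧ LawEq τ a b ∧
      ν ∈ fourPeriodicGGMs hG ρ β ∧ Assigned hG ρ β a b ν := by
    intro h4
    obtain ⟨a, b, ha, hb, hab, hs, hl⟩ :=
      exists_lawEq_of_sum h2 (upperSum_spec h4).1 (lt_mul_upperSum h4)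
    obtain ⟨ν, m, H⟩ := hl.exists_mem hG hdeg ρ hβ hτ ha hb
    exact ⟨a, b, ν, ha, hb, hab, hs, hl, m, H⟩
  have hdiag : 6 < τ → ∃ x ν, 1 < x ∧ 2 * x ^ 2 - (τ - 2) * x + 2 = 0 ∧
      ν ∈ fourPeriodicGGMs hG ρ β ∧ Assigned hG ρ β x x ν := by
    intro h6
    obtain ⟨x, hx, hl⟩ := exists_diag_solution h6
    obtain ⟨ν, m, H⟩ := ((lawEq_diag h2).2 (Or.inr hl)).exists_mem hG hdeg ρ hβ hτ
      (by linarith : 0 < x) (by linarith)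
    exact ⟨x, ν, hx, hl, m, H⟩
  refine ⟨fun h4 => ?_, fun h4 h6 => ?_, fun h6 h7 => ?_, fun h7 => ?_⟩
  · rw [Set.encard_eq_one]
    refine ⟨ν₁, Set.eq_singleton_iff_unique_mem.2 ⟨m₁, fun ν hν => ?_⟩⟩
    obtain ⟨a, b, ha, hb, hl, H⟩ := (hmem ν).1 hν
    by_cases hab : a = b
    · subst hab
      obtain rfl : a = 1 := ((lawEq_diag h2).1 hl).elim id (eq_one_of_diag (by linarith) ha)
      exact H.unique H₁
    · have h8 := hl.lt_of_ne h2 ha hb hab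
      have hq := ((lawEq_offDiag h2 hab).1 hl).1
      -- For τ ≤ 4, τs > 8 forces s > 2, while s² = τ(s - 1) ≤ 4(s - 1) gives (s - 2)² ≤ 0.
      have hs : 2 < a + b := by nlinarith
      nlinarith [sq_pos_of_pos (sub_pos.2 hs)]
  · obtain ⟨a₂, b₂, ν₂, ha₂, hb₂, hab₂, hs₂, hl₂, m₂, H₂⟩ := hupper h4
    have n12 : ν₁ ≠ ν₂ := H₁.ne_of_ne_of_eq hdeg one_pos ha₂ hb₂ hab₂ H₂
    rw [show fourPeriodicGGMs hG ρ β = {ν₁, ν₂} from ?_, Set.encard_pair n12]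
    ext ν
    refine ⟨fun hν => ?_, by rintro (rfl | rfl) <;> assumption⟩
    obtain ⟨a, b, ha, hb, hl, H⟩ := (hmem ν).1 hν
    by_cases hab : a = b
    · subst hab
      obtain rfl : a = 1 := ((lawEq_diag h2).1 hl).elim id (eq_one_of_diag h6 ha)
      exact Or.inl (H.unique H₁)
    · have h8 := hl.lt_of_ne h2 ha hb hab
      rcases eq_upperSum_or h4 ((lawEq_offDiag h2 hab).1 hl).1 with hs | hs
      · exact Or.inr (H.eq_of_sum h2 hab hab₂ hl hl₂ (hs.trans hs₂.symm) H₂)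
      -- The smaller sum would require τ > 2 + 2√5, which exceeds 6.
      · rw [hs, lt_mul_lowerSum_iff h4] at h8
        linarith
  · have h4 : 4 < τ := by linarith
    obtain ⟨a₂, b₂, ν₂, ha₂, hb₂, hab₂, hs₂, hl₂, m₂, H₂⟩ := hupper h4
    obtain ⟨x, ν₃, hx, hl₃, m₃, H₃⟩ := hdiag h6
    have n12 : ν₁ ≠ ν₂ := H₁.ne_of_ne_of_eq hdeg one_pos ha₂ hb₂ hab₂ H₂
    have n13 : ν₁ ≠ ν₃ := H₁.ne_of_one_lt hdeg hx H₃
    have n32 : ν₃ ≠ ν₂ := H₃.ne_of_ne_of_eq hdeg (by linarith) ha₂ hb₂ hab₂ H₂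
    rw [Set.encard_eq_three]
    refine ⟨ν₁, ν₂, ν₃, n12, n13, n32.symm, ?_⟩
    ext ν
    refine ⟨fun hν => ?_, by rintro (rfl | rfl | rfl) <;> assumption⟩
    obtain ⟨a, b, ha, hb, hl, H⟩ := (hmem ν).1 hν
    by_cases hab : a = b
    · subst hab
      rcases (lawEq_diag h2).1 hl with rfl | hl
      · exact Or.inl (H.unique H₁)
      · exact Or.inr (Or.inr (H.eq_of_diag ha hl hl₃ H₃))
    · have h8 := hl.lt_of_ne h2 ha hb hab
      rcases eq_upperSum_or h4 ((lawEq_offDiag h2 hab).1 hl).1 with hs | hs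
      · exact Or.inr (Or.inl (H.eq_of_sum h2 hab hab₂ hl hl₂ (hs.trans hs₂.symm) H₂))
      · rw [hs, lt_mul_lowerSum_iff h4] at h8
        linarith
  · have h6 : 6 < τ := by linarith
    have h4 : 4 < τ := by linarith
    obtain ⟨a₂, b₂, ν₂, ha₂, hb₂, hab₂, hs₂, hl₂, m₂, H₂⟩ := hupper h4
    obtain ⟨x, ν₃, hx, hl₃, m₃, H₃⟩ := hdiag h6
    obtain ⟨a₄, b₄, ha₄, hb₄, hab₄, hs₄, hl₄⟩ :=
      exists_lawEq_of_sum h2 (lowerSum_spec h4) ((lt_mul_lowerSum_iff h4).2 h7)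
    obtain ⟨ν₄, m₄, H₄⟩ := hl₄.exists_mem hG hdeg ρ hβ hτ ha₄ hb₄
    have n12 : ν₁ ≠ ν₂ := H₁.ne_of_ne_of_eq hdeg one_pos ha₂ hb₂ hab₂ H₂
    have n13 : ν₁ ≠ ν₃ := H₁.ne_of_one_lt hdeg hx H₃
    have n32 : ν₃ ≠ ν₂ := H₃.ne_of_ne_of_eq hdeg (by linarith) ha₂ hb₂ hab₂ H₂
    have n14 : ν₁ ≠ ν₄ := H₁.ne_of_ne_of_eq hdeg one_pos ha₄ hb₄ hab₄ H₄
    have n34 : ν₃ ≠ ν₄ := H₃.ne_of_ne_of_eq hdeg (by linarith) ha₄ hb₄ hab₄ H₄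
    have n24 : ν₂ ≠ ν₄ := by
      refine H₂.ne_of_sum_ne hdeg ha₂ hb₂ ha₄ hb₄ hab₂ ?_ H₄
      rw [hs₂, hs₄]
      have := (upperSum_spec h4).2
      intro h; linarith
    have hset : fourPeriodicGGMs hG ρ β = insert ν₄ {ν₁, ν₂, ν₃} := by
      ext ν
      refine ⟨fun hν => ?_, by rintro (rfl | rfl | rfl | rfl) <;> assumption⟩
      obtain ⟨a, b, ha, hb, hl, H⟩ := (hmem ν).1 hν
      by_cases hab : a = b
      · subst hab
        rcases (lawEq_diag h2).1 hl with rfl | hl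
        · exact Or.inr (Or.inl (H.unique H₁))
        · exact Or.inr (Or.inr (Or.inr (H.eq_of_diag ha hl hl₃ H₃)))
      · rcases eq_upperSum_or h4 ((lawEq_offDiag h2 hab).1 hl).1 with hs | hs
        · exact Or.inr (Or.inr (Or.inl (H.eq_of_sum h2 hab hab₂ hl hl₂ (hs.trans hs₂.symm) H₂)))
        · exact Or.inl (H.eq_of_sum h2 hab hab₄ hl hl₄ (hs.trans hs₄.symm) H₄)
    have h3 : ({ν₁, ν₂, ν₃} : Set (Measure (GradConf G ρ))).encard = 3 :=
      Set.encard_eq_three.2 ⟨ν₁, ν₂, ν₃, n12, n13, n32.symm, rfl⟩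
    rw [hset, Set.encard_insert_of_notMem, h3]
    · norm_num
    · rintro (h | h | h)
      · exact n14 h.symm
      · exact n24 h.symm
      · exact n34 h.symm

end Counting

end SOS

end

theorem mainTheorem1 {V : Type*} (G : SimpleGraph V) [G.LocallyFinite] (hG : G.IsTree)
    (hdeg : G.IsRegularOfDegree 3) (ρ : V) (β : ℝ) (hβ : 0 < β) (τ : ℝ)
    (hτ : τ = 2 * Real.cosh β) :
    (τ ≤ 4 → (SOS.fourPeriodicGGMs hG ρ β).encard = 1) ∧
    (4 < τ → τ ≤ 6 → (SOS.fourPeriodicGGMs hG ρ β).encard = 2) ∧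
    (6 < τ → τ ≤ 2 + 2 * √5 → (SOS.fourPeriodicGGMs hG ρ β).encard = 3) ∧
    (2 + 2 * √5 < τ → (SOS.fourPeriodicGGMs hG ρ β).encard = 4) :=
  SOS.encard_fourPeriodicGGMs G hG hdeg ρ β hβ τ hτ
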